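/- All graphs are finite and simple. For a graph $X$ with vertex coloring $c$, let $\mathrm{Qut}_c(X)$ be its quantum automorphism group: the compact matrix quantum group whose algebra $C(\mathrm{Qut}_c(X))$ is the universal unital $C^*$-algebra with generators $u_{ij}$ ($i,j\in V(X)$) and relations $u_{ij}=u_{ij}^*=u_{ij}^2$, $\sum_k u_{ik}=1=\sum_k u_{kj}$, $u_{ij}u_{kl}=0$ if exactly one of $ik\in E(X)$, $jl\in E(X)$ holds, and $u_{ij}=0$ if $c(i)\ne c(j)$, with comultiplication $\Delta(u_{ij})=\sum_k u_{ik}\otimes u_{kj}$ (values in the minimal tensor product). Write $\mathrm{Qut}(X)$ if all vertices have the same color, and $\mathrm{Qut}_r(T)$ for a rooted tree $(T,r)$ in which the root has one color and all other vertices have a second color. Quantum groups are isomorphic ($\cong$) if there is a $*$-isomorphism of their $C^*$-algebras that intertwines the comultiplications. **Lemma.** For every rooted tree $(T,r)$ there is an (unrooted) tree $T'$ with $\mathrm{Qut}(T')\cong\mathrm{Qut}_r(T)$. More precisely: 1. If $T$ is a path rooted at one of its endpoints (the one-vertex tree included), then $\mathrm{Qut}(K_1)\cong\mathrm{Qut}_r(T)$,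 so one may take $T'=K_1$. 2. Otherwise one may take for $T'$ the tree obtained from the disjoint union of $T$ and a path $P$ with $2|V(T)|$ edges by adding one new vertex, adjacent to exactly $r$ and one endpoint of $P$; that is, this $T'$ is a tree and $\mathrm{Qut}(T')\cong\mathrm{Qut}_r(T)$. -/

import Mathlib

open scoped TensorProduct

universe u v

/-- A C*-seminorm on a unital *-algebra over `ℂ`: a submultiplicative seminorm satisfying the
C*-inequality. -/
structure CStarSeminorm (P : Type u) [Ring P] [StarRing P] [Algebra ℂ P] extends
    Seminorm ℂ P where
  mul_le' : ∀ x y, toFun (x * y) ≤ toFun x * toFun y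
  sq_le' : ∀ x, toFun x ^ 2 ≤ toFun (star x * x)

namespace CStarSeminorm

section Basic

variable {P : Type u} [Ring P] [StarRing P] [Algebra ℂ P]

instance : FunLike (CStarSeminorm P) P ℝ where
  coe p := p.toFun
  coe_injective := by
    rintro ⟨p, _, _⟩ ⟨q, _, _⟩ h
    have : p = q := DFunLike.coe_injective h
    subst this
    rfl

instance : SeminormClass (CStarSeminorm P) ℂ P where
  map_zero p := p.toSeminorm.map_zero'
  map_add_le_add p := p.toSeminorm.add_le'
  map_neg_eq_map p := p.toSeminorm.neg'
  map_smul_eq_mul p := p.toSeminorm.smul'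

theorem mul_le (p : CStarSeminorm P) (x y : P) : p (x * y) ≤ p x * p y := p.mul_le' x y

theorem sq_le (p : CStarSeminorm P) (x : P) : p x ^ 2 ≤ p (star x * x) := p.sq_le' x

theorem nonneg (p : CStarSeminorm P) (x : P) : 0 ≤ p x := apply_nonneg p x

theorem le_star (p : CStarSeminorm P) (x : P) : p x ≤ p (star x) := by
  rcases (p.nonneg x).eq_or_lt with h | h
  · rw [← h]; exact p.nonneg _
  · have := (p.sq_le x).trans (p.mul_le _ _)
    nlinarith

theorem map_star (p : CStarSeminorm P) (x : P) : p (star x) = p x :=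
  le_antisymm (by simpa using p.le_star (star x)) (p.le_star x)

/-- The pointwise supremum of a pointwise bounded set of C*-seminorms. -/
noncomputable def sup (S : Set (CStarSeminorm P))
    (hS : ∀ x, BddAbove ((fun p : CStarSeminorm P => p x) '' S)) : CStarSeminorm P :=
  have nn : ∀ x, 0 ≤ sSup ((fun p : CStarSeminorm P => p x) '' S) := fun x =>
    Real.sSup_nonneg (by rintro _ ⟨p, _, rfl⟩; exact p.nonneg x)
  have le : ∀ p ∈ S, ∀ x, p x ≤ sSup ((fun p : CStarSeminorm P => p x) '' S) :=
    fun p hp x => le_csSup (hS x) ⟨p, hp, rfl⟩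
  { Seminorm.of (fun x => sSup ((fun p : CStarSeminorm P => p x) '' S))
      (fun x y => Real.sSup_le (by
        rintro _ ⟨p, hp, rfl⟩
        exact (map_add_le_add p x y).trans (add_le_add (le p hp x) (le p hp y)))
        (add_nonneg (nn x) (nn y)))
      (fun a x => by
        rw [← smul_eq_mul, ← Real.sSup_smul_of_nonneg (norm_nonneg a), ← Set.image_smul,
          Set.image_image]
        simp [map_smul_eq_mul]) with
    mul_le' := fun x y => Real.sSup_le (by
        rintro _ ⟨p, hp, rfl⟩
        exact (p.mul_le x y).trans
          (mul_le_mul (le p hp x) (le p hp y) (p.nonneg y) (nn x)))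
        (mul_nonneg (nn x) (nn y))
    sq_le' := fun x => by
      refine (Real.le_sqrt (nn x) (nn _)).1 (Real.sSup_le ?_ (Real.sqrt_nonneg _))
      rintro _ ⟨p, hp, rfl⟩
      exact Real.le_sqrt_of_sq_le ((p.sq_le x).trans (le p hp _)) }

theorem sup_apply (S : Set (CStarSeminorm P)) (hS) (x : P) :
    sup S hS x = sSup ((fun p : CStarSeminorm P => p x) '' S) := rfl

theorem le_sup {S : Set (CStarSeminorm P)} (hS) {p : CStarSeminorm P} (hp : p ∈ S) (x : P) :
    p x ≤ sup S hS x :=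
  le_csSup (hS x) ⟨p, hp, rfl⟩

theorem sup_le {S : Set (CStarSeminorm P)} (hS) {x : P} {C : ℝ} (hC : 0 ≤ C)
    (h : ∀ p ∈ S, p x ≤ C) : sup S hS x ≤ C :=
  Real.sSup_le (by rintro _ ⟨p, hp, rfl⟩; exact h p hp) hC

end Basic

section Completion

variable {P : Type u} [Ring P] [StarRing P] [Algebra ℂ P]

/-- The *-algebra `P` regarded as a seminormed algebra via the C*-seminorm `p`. -/
def Pre (_p : CStarSeminorm P) : Type u := P

instance (p : CStarSeminorm P) : Ring p.Pre := inferInstanceAs (Ring P)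
instance (p : CStarSeminorm P) : StarRing p.Pre := inferInstanceAs (StarRing P)
instance (p : CStarSeminorm P) : Algebra ℂ p.Pre := inferInstanceAs (Algebra ℂ P)
instance [StarModule ℂ P] (p : CStarSeminorm P) : StarModule ℂ p.Pre := inferInstanceAs (StarModule ℂ P)

noncomputable instance (p : CStarSeminorm P) : SeminormedRing p.Pre :=
  { (inferInstance : Ring p.Pre),
    AddGroupSeminorm.toSeminormedAddCommGroup (E := p.Pre) p.toAddGroupSeminorm with
    norm_mul_le := p.mul_le }

theorem Pre.norm_def (p : CStarSeminorm P) (x : p.Pre) : ‖x‖ = p x := rfl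

noncomputable instance (p : CStarSeminorm P) : NormedAlgebra ℂ p.Pre where
  norm_smul_le a x := (map_smul_eq_mul p a x).le

instance (p : CStarSeminorm P) : NormedStarGroup p.Pre where
  norm_star_le x := (p.map_star x).le

/-- The C*-algebra obtained from the *-algebra `P` by dividing out the null space of the
C*-seminorm `p` and completing. -/
def Compl (p : CStarSeminorm P) : Type u := UniformSpace.Completion p.Pre

open UniformSpace in
noncomputable instance (p : CStarSeminorm P) : NormedRing p.Compl :=
  inferInstanceAs (NormedRing (Completion p.Pre))

open UniformSpace in
noncomputable instance (p : CStarSeminorm P) : NormedAlgebra ℂ p.Compl :=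
  { (inferInstanceAs (Algebra ℂ (Completion p.Pre)) : Algebra ℂ p.Compl) with
    norm_smul_le := fun a x => norm_smul_le (β := Completion p.Pre) a x }

instance (p : CStarSeminorm P) : CompleteSpace p.Compl :=
  inferInstanceAs (CompleteSpace (UniformSpace.Completion p.Pre))

/-- The canonical map from `P` to its completion, as a function. -/
noncomputable def toCompl (p : CStarSeminorm P) (x : P) : p.Compl :=
  ((show p.Pre from x : p.Pre) : UniformSpace.Completion p.Pre)

variable (p : CStarSeminorm P)

theorem norm_toCompl (x : P) : ‖p.toCompl x‖ = p x :=
  UniformSpace.Completion.norm_coe (E := p.Pre) x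

theorem denseRange_toCompl : DenseRange p.toCompl :=
  UniformSpace.Completion.denseRange_coe (α := p.Pre)

theorem toCompl_add (x y : P) : p.toCompl (x + y) = p.toCompl x + p.toCompl y :=
  UniformSpace.Completion.coe_add (α := p.Pre) x y

theorem toCompl_mul (x y : P) : p.toCompl (x * y) = p.toCompl x * p.toCompl y :=
  UniformSpace.Completion.coe_mul (α := p.Pre) x y

theorem toCompl_one : p.toCompl 1 = 1 := UniformSpace.Completion.coe_one p.Pre

theorem toCompl_zero : p.toCompl 0 = 0 := UniformSpace.Completion.coe_zero (α := p.Pre)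

theorem toCompl_smul (a : ℂ) (x : P) : p.toCompl (a • x) = a • p.toCompl x :=
  UniformSpace.Completion.coe_smul (X := p.Pre) a x

/-- Prove a closed condition on the completion by checking it on the image of `P`. -/
theorem compl_induction {C : p.Compl → Prop} (x : p.Compl) (hc : IsClosed {x | C x})
    (h : ∀ x, C (p.toCompl x)) : C x :=
  p.denseRange_toCompl.induction_on x hc h

noncomputable instance : Star p.Compl where
  star := UniformSpace.Completion.map (star : p.Pre → p.Pre)

theorem continuous_star_compl : Continuous (star : p.Compl → p.Compl) :=
  UniformSpace.Completion.continuous_map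

theorem toCompl_star (x : P) : p.toCompl (star x) = star (p.toCompl x) :=
  (UniformSpace.Completion.map_coe
    (NormedStarGroup.to_continuousStar (E := p.Pre) |> fun _ => star_isometry.uniformContinuous)
    (show p.Pre from x)).symm

noncomputable instance : StarRing p.Compl where
  star_involutive x := by
    have hs := p.continuous_star_compl
    refine p.compl_induction (C := fun x => star (star x) = x) x
      (isClosed_eq (hs.comp hs) continuous_id) fun x => ?_
    rw [← toCompl_star, ← toCompl_star, star_star]
  star_mul x y := by
    have hs := p.continuous_star_compl
    refine p.compl_induction (C := fun x => star (x * y) = star y * star x) x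
      (isClosed_eq (hs.comp (by fun_prop)) (by fun_prop)) fun x => ?_
    refine p.compl_induction (C := fun y => star (p.toCompl x * y) = star y * star (p.toCompl x)) y
      (isClosed_eq (hs.comp (by fun_prop)) (by fun_prop)) fun y => ?_
    simp only [← toCompl_star, ← toCompl_mul, star_mul]
  star_add x y := by
    have hs := p.continuous_star_compl
    refine p.compl_induction (C := fun x => star (x + y) = star x + star y) x
      (isClosed_eq (hs.comp (by fun_prop)) (by fun_prop)) fun x => ?_
    refine p.compl_induction (C := fun y => star (p.toCompl x + y) = star (p.toCompl x) + star y) y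
      (isClosed_eq (hs.comp (by fun_prop)) (by fun_prop)) fun y => ?_
    simp only [← toCompl_star, ← toCompl_add, star_add]

instance : CStarRing p.Compl where
  norm_mul_self_le x := by
    have hs := p.continuous_star_compl
    refine p.compl_induction (C := fun x => ‖x‖ * ‖x‖ ≤ ‖star x * x‖) x
      (isClosed_le (continuous_norm.mul continuous_norm)
        (continuous_norm.comp (hs.mul continuous_id))) fun x => ?_
    rw [← toCompl_star, ← toCompl_mul, norm_toCompl, norm_toCompl, ← sq]
    exact p.sq_le x

instance [StarModule ℂ P] : StarModule ℂ p.Compl where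
  star_smul a x := by
    have hs := p.continuous_star_compl
    refine p.compl_induction (C := fun x => star (a • x) = star a • star x) x
      (isClosed_eq (hs.comp (continuous_const_smul a)) (hs.const_smul (star a))) fun x => ?_
    rw [← toCompl_smul, ← toCompl_star, ← toCompl_star, ← toCompl_smul, star_smul]

noncomputable instance [StarModule ℂ P] : CStarAlgebra p.Compl where

/-- The canonical *-homomorphism from `P` to its completion. -/
noncomputable def ι : P →⋆ₐ[ℂ] p.Compl where
  toFun := p.toCompl
  map_one' := p.toCompl_one
  map_mul' := p.toCompl_mul
  map_zero' := p.toCompl_zero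
  map_add' := p.toCompl_add
  commutes' a := by
    rw [Algebra.algebraMap_eq_smul_one, toCompl_smul, toCompl_one, Algebra.algebraMap_eq_smul_one]
  map_star' := p.toCompl_star

theorem norm_ι (x : P) : ‖p.ι x‖ = p x := p.norm_toCompl x

theorem denseRange_ι : DenseRange p.ι := p.denseRange_toCompl

variable {p}

theorem hom_continuous {B : Type v} [CStarAlgebra B] (f : P →⋆ₐ[ℂ] B) (hf : ∀ x, ‖f x‖ ≤ p x) :
    Continuous (show p.Pre →+* B from (f : P →+* B)) :=
  AddMonoidHomClass.continuous_of_bound (show p.Pre →+* B from (f : P →+* B)) 1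
    (fun x => by rw [one_mul]; exact hf x)

/-- A *-homomorphism dominated by the C*-seminorm `p` extends to the completion. -/
noncomputable def lift {B : Type v} [CStarAlgebra B] (f : P →⋆ₐ[ℂ] B) (hf : ∀ x, ‖f x‖ ≤ p x) :
    p.Compl →⋆ₐ[ℂ] B :=
  let F : p.Compl →+* B := UniformSpace.Completion.extensionHom
    (show p.Pre →+* B from (f : P →+* B)) (hom_continuous f hf)
  have hF : ∀ x, F (p.ι x) = f x := fun x =>
    UniformSpace.Completion.extensionHom_coe _ (hom_continuous f hf) (show p.Pre from x)
  have hc : Continuous F := UniformSpace.Completion.continuous_extension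
  { F with
    commutes' := fun a => by
      have h := hF (algebraMap ℂ P a)
      rw [AlgHomClass.commutes f] at h
      rw [← h, AlgHomClass.commutes p.ι]
      rfl
    map_star' := fun x => by
      have hs := p.continuous_star_compl
      refine p.compl_induction (C := fun x => F (star x) = star (F x)) x
        (isClosed_eq (hc.comp hs) hc.star) fun x => ?_
      change F (star (p.ι x)) = star (F (p.ι x))
      rw [← StarHomClass.map_star p.ι, hF, hF, StarHomClass.map_star f] }

theorem lift_ι {B : Type v} [CStarAlgebra B] (f : P →⋆ₐ[ℂ] B) (hf : ∀ x, ‖f x‖ ≤ p x) (x : P) :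
    lift f hf (p.ι x) = f x :=
  UniformSpace.Completion.extensionHom_coe _ (hom_continuous f hf) (show p.Pre from x)

end Completion

/-- The C*-seminorm `x ↦ ‖f x‖` defined by a *-homomorphism `f` into a C*-algebra. -/
noncomputable def ofHom {P : Type u} [Ring P] [StarRing P] [Algebra ℂ P]
    {B : Type v} [CStarAlgebra B] (f : P →⋆ₐ[ℂ] B) : CStarSeminorm P :=
  { Seminorm.of (fun x => ‖f x‖) (fun x y => by rw [map_add]; exact norm_add_le _ _)
      (fun a x => by rw [map_smul, norm_smul]) with
    mul_le' := fun x y => by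
      change ‖f (x * y)‖ ≤ ‖f x‖ * ‖f y‖
      rw [map_mul]; exact norm_mul_le _ _
    sq_le' := fun x => by
      change ‖f x‖ ^ 2 ≤ ‖f (star x * x)‖
      rw [map_mul, StarHomClass.map_star, CStarRing.norm_star_mul_self, sq] }

theorem ofHom_apply {P : Type u} [Ring P] [StarRing P] [Algebra ℂ P]
    {B : Type v} [CStarAlgebra B] (f : P →⋆ₐ[ℂ] B) (x : P) : ofHom f x = ‖f x‖ := rfl

end CStarSeminorm

/-! ### The minimal (spatial) tensor product of C*-algebras -/

section MinTensor

/-- The representation `a ⊗ b ↦ π a ⊗ ρ b` of the algebraic tensor product on the tensor product of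
the Hilbert spaces `H` and `K`. -/
noncomputable def tensorRep {A B : Type u} [CStarAlgebra A] [CStarAlgebra B] {H K : Type u}
    [NormedAddCommGroup H] [InnerProductSpace ℂ H] [CompleteSpace H]
    [NormedAddCommGroup K] [InnerProductSpace ℂ K] [CompleteSpace K]
    (π : A →⋆ₐ[ℂ] (H →L[ℂ] H)) (ρ : B →⋆ₐ[ℂ] (K →L[ℂ] K)) :
    A ⊗[ℂ] B →ₐ[ℂ] ((H ⊗[ℂ] K) →L[ℂ] (H ⊗[ℂ] K)) :=
  Algebra.TensorProduct.algHomOfLinearMapTensorProduct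
    (TensorProduct.lift (LinearMap.mk₂ ℂ (fun a b => TensorProduct.mapL (π a) (ρ b))
      (fun a a' b => by rw [map_add, TensorProduct.mapL_add_left])
      (fun c a b => by rw [map_smul, TensorProduct.mapL_smul_left])
      (fun a b b' => by rw [map_add, TensorProduct.mapL_add_right])
      (fun c a b => by rw [map_smul, TensorProduct.mapL_smul_right])))
    (fun a a' b b' => by simp [TensorProduct.mapL_mul])
    (by simp [ContinuousLinearMap.one_def])

section

variable {A B : Type u} [CStarAlgebra A] [CStarAlgebra B] {H K : Type u}
    [NormedAddCommGroup H] [InnerProductSpace ℂ H] [CompleteSpace H]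
    [NormedAddCommGroup K] [InnerProductSpace ℂ K] [CompleteSpace K]
    (π : A →⋆ₐ[ℂ] (H →L[ℂ] H)) (ρ : B →⋆ₐ[ℂ] (K →L[ℂ] K))

theorem tensorRep_tmul (a : A) (b : B) :
    tensorRep π ρ (a ⊗ₜ b) = TensorProduct.mapL (π a) (ρ b) := by
  rfl

theorem inner_tensorRep (x : A ⊗[ℂ] B) (ξ η : H ⊗[ℂ] K) :
    inner ℂ (tensorRep π ρ x ξ) η = inner ℂ ξ (tensorRep π ρ (star x) η) := by
  induction x using TensorProduct.induction_on generalizing ξ η with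
  | zero => simp
  | add x y hx hy =>
    simp [map_add, inner_add_left, inner_add_right, hx, hy]
  | tmul a b =>
    induction ξ using TensorProduct.induction_on generalizing η with
    | zero => simp
    | add ξ ζ hξ hζ => simp [map_add, inner_add_left, hξ, hζ]
    | tmul h k =>
      induction η using TensorProduct.induction_on with
      | zero => simp
      | add ξ ζ hξ hζ => simp only [map_add, inner_add_right, hξ, hζ]
      | tmul h' k' =>
        rw [TensorProduct.star_tmul, tensorRep_tmul, tensorRep_tmul, StarHomClass.map_star,
          StarHomClass.map_star, TensorProduct.mapL_tmul, TensorProduct.mapL_tmul,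
          TensorProduct.inner_tmul, TensorProduct.inner_tmul,
          ContinuousLinearMap.star_eq_adjoint, ContinuousLinearMap.star_eq_adjoint,
          ContinuousLinearMap.adjoint_inner_right, ContinuousLinearMap.adjoint_inner_right]

/-- The C*-seminorm `x ↦ ‖(π ⊗ ρ) x‖` on the algebraic tensor product. -/
noncomputable def spatialSeminorm : CStarSeminorm (A ⊗[ℂ] B) :=
  { Seminorm.of (fun x => ‖tensorRep π ρ x‖)
      (fun x y => by
        rw [map_add]; exact ContinuousLinearMap.opNorm_add_le _ _)
      (fun a x => by
        rw [map_smul]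
        refine le_antisymm (ContinuousLinearMap.opNorm_smul_le _ _) ?_
        rcases eq_or_ne a 0 with rfl | ha
        · rw [norm_zero, zero_mul]; exact ContinuousLinearMap.opNorm_nonneg _
        · have h := ContinuousLinearMap.opNorm_smul_le a⁻¹ (a • tensorRep π ρ x)
          rw [smul_smul, inv_mul_cancel₀ ha, one_smul, norm_inv] at h
          rwa [← le_inv_mul_iff₀ (norm_pos_iff.2 ha)]) with
    mul_le' := fun x y => by
      change ‖tensorRep π ρ (x * y)‖ ≤ ‖tensorRep π ρ x‖ * ‖tensorRep π ρ y‖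
      rw [map_mul]; exact ContinuousLinearMap.opNorm_comp_le _ _
    sq_le' := fun x => by
      change ‖tensorRep π ρ x‖ ^ 2 ≤ ‖tensorRep π ρ (star x * x)‖
      refine (Real.le_sqrt (ContinuousLinearMap.opNorm_nonneg _)
        (ContinuousLinearMap.opNorm_nonneg _)).1 ?_
      refine ContinuousLinearMap.opNorm_le_bound _ (Real.sqrt_nonneg _) fun ξ => ?_
      rw [← Real.sqrt_sq (norm_nonneg ξ), ← Real.sqrt_mul (ContinuousLinearMap.opNorm_nonneg _)]
      refine Real.le_sqrt_of_sq_le ?_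
      have h1 : inner ℂ (tensorRep π ρ x ξ) (tensorRep π ρ x ξ) =
          inner ℂ ξ (tensorRep π ρ (star x * x) ξ) := by
        rw [inner_tensorRep, map_mul]; rfl
      calc ‖tensorRep π ρ x ξ‖ ^ 2
          = ‖(inner ℂ (tensorRep π ρ x ξ) (tensorRep π ρ x ξ) : ℂ)‖ := by
            have h2 : (inner ℂ (tensorRep π ρ x ξ) (tensorRep π ρ x ξ) : ℂ) =
                (‖tensorRep π ρ x ξ‖ : ℂ) ^ 2 :=
              inner_self_eq_norm_sq_to_K (𝕜 := ℂ) (tensorRep π ρ x ξ)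
            rw [h2, norm_pow, Complex.norm_real, norm_norm]
        _ = ‖(inner ℂ ξ (tensorRep π ρ (star x * x) ξ) : ℂ)‖ := by rw [h1]
        _ ≤ ‖ξ‖ * ‖tensorRep π ρ (star x * x) ξ‖ :=
            norm_inner_le_norm (𝕜 := ℂ) (E := H ⊗[ℂ] K) _ _
        _ ≤ ‖ξ‖ * (‖tensorRep π ρ (star x * x)‖ * ‖ξ‖) := by
            gcongr; exact ContinuousLinearMap.le_opNorm _ _
        _ = _ := by ring }

theorem spatialSeminorm_apply (x : A ⊗[ℂ] B) : spatialSeminorm π ρ x = ‖tensorRep π ρ x‖ := rfl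

end

/-- All C*-seminorms on `A ⊗ B` that come from a pair of representations of `A` and `B`. -/
def spatialSeminorms (A B : Type u) [CStarAlgebra A] [CStarAlgebra B] :
    Set (CStarSeminorm (A ⊗[ℂ] B)) :=
  {p | ∃ (H K : Type u) (_ : NormedAddCommGroup H) (_ : InnerProductSpace ℂ H)
      (_ : CompleteSpace H) (_ : NormedAddCommGroup K) (_ : InnerProductSpace ℂ K)
      (_ : CompleteSpace K) (π : A →⋆ₐ[ℂ] (H →L[ℂ] H)) (ρ : B →⋆ₐ[ℂ] (K →L[ℂ] K)),
      p = spatialSeminorm π ρ}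

theorem bddAbove_spatialSeminorms (A B : Type u) [CStarAlgebra A] [CStarAlgebra B]
    (x : A ⊗[ℂ] B) :
    BddAbove ((fun p : CStarSeminorm (A ⊗[ℂ] B) => p x) '' spatialSeminorms A B) := by
  suffices h : ∃ C, ∀ p ∈ spatialSeminorms A B, p x ≤ C by
    obtain ⟨C, hC⟩ := h
    exact ⟨C, by rintro _ ⟨p, hp, rfl⟩; exact hC p hp⟩
  induction x using TensorProduct.induction_on with
  | zero => exact ⟨0, fun p _ => (map_zero p).le⟩
  | add x y hx hy =>
    obtain ⟨C, hC⟩ := hx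
    obtain ⟨D, hD⟩ := hy
    exact ⟨C + D, fun p hp => (map_add_le_add p x y).trans (add_le_add (hC p hp) (hD p hp))⟩
  | tmul a b =>
    refine ⟨‖a‖ * ‖b‖, ?_⟩
    rintro _ ⟨H, K, _, _, _, _, _, _, π, ρ, rfl⟩
    rw [spatialSeminorm_apply, tensorRep_tmul]
    refine (TensorProduct.norm_mapL_le _ _).trans ?_
    exact mul_le_mul (NonUnitalStarAlgHom.norm_apply_le π a) (NonUnitalStarAlgHom.norm_apply_le ρ b)
      (norm_nonneg _) (norm_nonneg _)

/-- The minimal (spatial) C*-norm on the algebraic tensor product: the supremum of `‖(π ⊗ ρ) x‖`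
over all pairs of representations `π` of `A` and `ρ` of `B` on Hilbert spaces. -/
noncomputable def minNorm (A B : Type u) [CStarAlgebra A] [CStarAlgebra B] :
    CStarSeminorm (A ⊗[ℂ] B) :=
  CStarSeminorm.sup (spatialSeminorms A B) (bddAbove_spatialSeminorms A B)

/-- The minimal C*-tensor product of two C*-algebras. -/
abbrev MinTensor (A B : Type u) [CStarAlgebra A] [CStarAlgebra B] : Type u := (minNorm A B).Compl

namespace MinTensor

variable {A B C D : Type u} [CStarAlgebra A] [CStarAlgebra B] [CStarAlgebra C] [CStarAlgebra D]

/-- The elementary tensor `a ⊗ b` in the minimal tensor product. -/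
noncomputable def tmul (a : A) (b : B) : MinTensor A B := (minNorm A B).ι (a ⊗ₜ b)

/-- The algebraic tensor product of two *-homomorphisms. -/
noncomputable def algMap (φ : A →⋆ₐ[ℂ] C) (ψ : B →⋆ₐ[ℂ] D) : A ⊗[ℂ] B →⋆ₐ[ℂ] C ⊗[ℂ] D :=
  { Algebra.TensorProduct.map (φ : A →ₐ[ℂ] C) (ψ : B →ₐ[ℂ] D) with
    map_star' := fun x => by
      change Algebra.TensorProduct.map (φ : A →ₐ[ℂ] C) (ψ : B →ₐ[ℂ] D) (star x) =
        star (Algebra.TensorProduct.map (φ : A →ₐ[ℂ] C) (ψ : B →ₐ[ℂ] D) x)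
      induction x using TensorProduct.induction_on with
      | zero => simp
      | add x y hx hy => simp only [star_add, map_add, hx, hy]
      | tmul a b => simp [StarHomClass.map_star] }

theorem algMap_tmul (φ : A →⋆ₐ[ℂ] C) (ψ : B →⋆ₐ[ℂ] D) (a : A) (b : B) :
    algMap φ ψ (a ⊗ₜ b) = φ a ⊗ₜ ψ b := rfl

theorem minNorm_algMap_le (φ : A →⋆ₐ[ℂ] C) (ψ : B →⋆ₐ[ℂ] D) (x : A ⊗[ℂ] B) :
    minNorm C D (algMap φ ψ x) ≤ minNorm A B x := by
  refine CStarSeminorm.sup_le _ ((minNorm A B).nonneg x) ?_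
  rintro _ ⟨H, K, _, _, _, _, _, _, π, ρ, rfl⟩
  have h : tensorRep π ρ (algMap φ ψ x) = tensorRep (π.comp φ) (ρ.comp ψ) x := by
    induction x using TensorProduct.induction_on with
    | zero => simp
    | add x y hx hy => simp only [map_add, hx, hy]
    | tmul a b => simp [algMap_tmul, tensorRep_tmul]
  rw [spatialSeminorm_apply, h, ← spatialSeminorm_apply]
  exact CStarSeminorm.le_sup (S := spatialSeminorms A B) _
    ⟨H, K, _, _, _, _, _, _, π.comp φ, ρ.comp ψ, rfl⟩ x

/-- The *-homomorphism `φ ⊗ ψ` between minimal tensor products. -/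
noncomputable def map (φ : A →⋆ₐ[ℂ] C) (ψ : B →⋆ₐ[ℂ] D) : MinTensor A B →⋆ₐ[ℂ] MinTensor C D :=
  CStarSeminorm.lift ((minNorm C D).ι.comp (algMap φ ψ)) (fun x => by
    rw [StarAlgHom.comp_apply, CStarSeminorm.norm_ι]
    exact minNorm_algMap_le φ ψ x)

theorem map_tmul (φ : A →⋆ₐ[ℂ] C) (ψ : B →⋆ₐ[ℂ] D) (a : A) (b : B) :
    map φ ψ (tmul a b) = tmul (φ a) (ψ b) :=
  CStarSeminorm.lift_ι _ _ _

end MinTensor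

end MinTensor

/-! ### Universal C*-algebras given by generators and relations -/

/-- The free unital *-algebra over `ℂ` on a set `X` of generators: noncommutative polynomials in
the letters `Sum.inl x` (the generator `x`) and `Sum.inr x` (its adjoint). -/
def FreeStarAlgebra (X : Type u) : Type u := MonoidAlgebra ℂ (FreeMonoid (X ⊕ X))

namespace FreeStarAlgebra

variable {X : Type u}

noncomputable instance : Ring (FreeStarAlgebra X) :=
  inferInstanceAs (Ring (MonoidAlgebra ℂ (FreeMonoid (X ⊕ X))))

noncomputable instance : Algebra ℂ (FreeStarAlgebra X) :=
  inferInstanceAs (Algebra ℂ (MonoidAlgebra ℂ (FreeMonoid (X ⊕ X))))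

/-- The adjoint of a word: reverse it and replace each letter by its adjoint. -/
def starWord (w : FreeMonoid (X ⊕ X)) : FreeMonoid (X ⊕ X) :=
  FreeMonoid.reverse (FreeMonoid.map Sum.swap w)

theorem starWord_mul (w w' : FreeMonoid (X ⊕ X)) :
    starWord (w * w') = starWord w' * starWord w := by
  simp [starWord, FreeMonoid.reverse_mul]

theorem starWord_starWord (w : FreeMonoid (X ⊕ X)) : starWord (starWord w) = w := by
  induction w using FreeMonoid.inductionOn with
  | one => rfl
  | of x => cases x <;> rfl
  | mul w w' h h' => rw [starWord_mul, starWord_mul, h, h']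

/-- The element `a • w` of the free *-algebra. -/
noncomputable def mono (w : FreeMonoid (X ⊕ X)) (a : ℂ) : FreeStarAlgebra X :=
  MonoidAlgebra.single w a

theorem mono_mul (w w' : FreeMonoid (X ⊕ X)) (a b : ℂ) :
    mono w a * mono w' b = mono (w * w') (a * b) :=
  MonoidAlgebra.single_mul_single ..

theorem mono_smul (w : FreeMonoid (X ⊕ X)) (a b : ℂ) : a • mono w b = mono w (a * b) :=
  MonoidAlgebra.smul_single ..

theorem mono_induction {C : FreeStarAlgebra X → Prop} (x : FreeStarAlgebra X) (h0 : C 0)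
    (hadd : ∀ x y, C x → C y → C (x + y)) (h : ∀ w a, C (mono w a)) : C x :=
  MonoidAlgebra.induction_linear (motive := C) x h0 hadd h

/-- The conjugate-linear involution, as an additive map. -/
noncomputable def starHom : FreeStarAlgebra X →+ FreeStarAlgebra X :=
  (Finsupp.liftAddHom (fun w => (MonoidAlgebra.singleAddHom (starWord w)).comp
    (starAddEquiv : ℂ ≃+ ℂ).toAddMonoidHom)).comp
    (MonoidAlgebra.coeffAddEquiv (R := ℂ) (M := FreeMonoid (X ⊕ X))).toAddMonoidHom

theorem starHom_mono (w : FreeMonoid (X ⊕ X)) (a : ℂ) :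
    starHom (mono w a) = mono (starWord w) (star a) := by
  exact Finsupp.liftAddHom_apply_single _ w a

noncomputable instance : StarRing (FreeStarAlgebra X) where
  star := starHom
  star_involutive x := by
    induction x using mono_induction with
    | h0 => simp
    | hadd x y hx hy => rw [map_add, map_add, hx, hy]
    | h w a => rw [starHom_mono, starHom_mono, starWord_starWord, star_star]
  star_mul x y := by
    change starHom (x * y) = starHom y * starHom x
    induction x using mono_induction with
    | h0 => simp
    | hadd x x' hx hx' => rw [add_mul, map_add, map_add, hx, hx', mul_add]
    | h w a =>
      induction y using mono_induction with
      | h0 => simp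
      | hadd x x' hx hx' => rw [mul_add, map_add, map_add, hx, hx', add_mul]
      | h w' b =>
        rw [mono_mul, starHom_mono, starHom_mono, starHom_mono, mono_mul, starWord_mul, star_mul]
  star_add x y := map_add starHom x y

theorem star_mono (w : FreeMonoid (X ⊕ X)) (a : ℂ) :
    star (mono w a) = mono (starWord w) (star a) := starHom_mono w a

instance : StarModule ℂ (FreeStarAlgebra X) where
  star_smul a x := by
    induction x using mono_induction with
    | h0 => simp
    | hadd x y hx hy => rw [smul_add, star_add, star_add, hx, hy, smul_add]
    | h w b => rw [mono_smul, star_mono, star_mono, mono_smul, star_mul, mul_comm]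

/-- The generator `x`. -/
noncomputable def gen (x : X) : FreeStarAlgebra X := mono (FreeMonoid.of (Sum.inl x)) 1

/-- Every element of the free *-algebra is built from scalars and generators. -/
theorem gen_induction {C : FreeStarAlgebra X → Prop} (x : FreeStarAlgebra X)
    (h1 : ∀ a, C (algebraMap ℂ _ a)) (hgen : ∀ x, C (gen x)) (hstar : ∀ x, C x → C (star x))
    (hadd : ∀ x y, C x → C y → C (x + y)) (hmul : ∀ x y, C x → C y → C (x * y)) : C x := by
  induction x using mono_induction with
  | h0 => simpa using h1 0
  | hadd x y hx hy => exact hadd x y hx hy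
  | h w a =>
    induction w using FreeMonoid.inductionOn generalizing a with
    | one => exact h1 a
    | mul w w' h h' => simpa [mono_mul] using hmul _ _ (h a) (h' 1)
    | of x =>
      have hs : ∀ x, mono (FreeMonoid.of x) a = algebraMap ℂ (FreeStarAlgebra X) a *
          mono (FreeMonoid.of x) 1 := fun x => by
        rw [← Algebra.smul_def, mono_smul, mul_one]
      rw [hs]
      refine hmul _ _ (h1 a) ?_
      cases x with
      | inl x => exact hgen x
      | inr x =>
        have : star (gen x) = mono (FreeMonoid.of (Sum.inr x)) 1 := by
          rw [gen, star_mono, star_one]; rfl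
        rw [← this]
        exact hstar _ (hgen x)

/-- The *-homomorphism that sends each generator `x` to `v x`. -/
noncomputable def lift {B : Type v} [Ring B] [StarRing B] [Algebra ℂ B] [StarModule ℂ B]
    (v : X → B) : FreeStarAlgebra X →⋆ₐ[ℂ] B :=
  let F : FreeStarAlgebra X →ₐ[ℂ] B := MonoidAlgebra.lift ℂ B (FreeMonoid (X ⊕ X))
    (FreeMonoid.lift (Sum.elim v (star ∘ v)))
  have hF : ∀ w a, F (mono w a) = a • FreeMonoid.lift (Sum.elim v (star ∘ v)) w := fun w a =>
    MonoidAlgebra.lift_single ..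
  { F with
    map_star' := fun x => by
      change F (star x) = star (F x)
      induction x using mono_induction with
      | h0 => simp
      | hadd x y hx hy => rw [star_add, map_add, map_add, hx, hy, star_add]
      | h w a =>
        rw [star_mono, hF, hF, star_smul]
        congr 1
        induction w using FreeMonoid.inductionOn with
        | one =>
          rw [show starWord (1 : FreeMonoid (X ⊕ X)) = 1 from rfl, map_one, star_one]
        | of x => cases x <;> simp [starWord]
        | mul w w' h h' => rw [starWord_mul, map_mul, map_mul, h, h', star_mul] }

theorem lift_gen {B : Type v} [Ring B] [StarRing B] [Algebra ℂ B] [StarModule ℂ B]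
    (v : X → B) (x : X) : lift v (gen x) = v x := by
  refine (MonoidAlgebra.lift_single ..).trans ?_
  simp

end FreeStarAlgebra

section Universal

variable {X : Type u}

/-- The C*-seminorms on the free *-algebra for which all the relations `r = 0`, `r ∈ R`, hold. -/
def relationSeminorms (R : Set (FreeStarAlgebra X)) : Set (CStarSeminorm (FreeStarAlgebra X)) :=
  {p | ∀ r ∈ R, p r = 0}

theorem bddAbove_relationSeminorms (R : Set (FreeStarAlgebra X))
    (hR : ∀ x, ∃ C, ∀ p ∈ relationSeminorms R, p (FreeStarAlgebra.gen x) ≤ C)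
    (x : FreeStarAlgebra X) :
    BddAbove ((fun p : CStarSeminorm (FreeStarAlgebra X) => p x) '' relationSeminorms R) := by
  suffices h : ∃ C, ∀ p ∈ relationSeminorms R, p x ≤ C by
    obtain ⟨C, hC⟩ := h
    exact ⟨C, by rintro _ ⟨p, hp, rfl⟩; exact hC p hp⟩
  induction x using FreeStarAlgebra.gen_induction with
  | h1 a =>
    refine ⟨‖a‖, fun p _ => ?_⟩
    have h1 : p 1 ≤ 1 := by
      have := p.sq_le 1
      rw [star_one, one_mul] at this
      nlinarith [p.nonneg 1]
    rw [Algebra.algebraMap_eq_smul_one, map_smul_eq_mul]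
    exact mul_le_of_le_one_right (norm_nonneg a) h1
  | hgen x => exact hR x
  | hstar x hx =>
    obtain ⟨C, hC⟩ := hx
    exact ⟨C, fun p hp => (p.map_star x).trans_le (hC p hp)⟩
  | hadd x y hx hy =>
    obtain ⟨C, hC⟩ := hx
    obtain ⟨D, hD⟩ := hy
    exact ⟨C + D, fun p hp => (map_add_le_add p x y).trans (add_le_add (hC p hp) (hD p hp))⟩
  | hmul x y hx hy =>
    obtain ⟨C, hC⟩ := hx
    obtain ⟨D, hD⟩ := hy
    exact ⟨C * D, fun p hp => (p.mul_le x y).trans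
      (mul_le_mul (hC p hp) (hD p hp) (p.nonneg y) ((p.nonneg x).trans (hC p hp)))⟩

/-- The largest C*-seminorm on the free *-algebra for which the relations `r = 0`, `r ∈ R`, hold;
it exists as soon as the relations bound every generator. -/
noncomputable def universalNorm (R : Set (FreeStarAlgebra X))
    (hR : ∀ x, ∃ C, ∀ p ∈ relationSeminorms R, p (FreeStarAlgebra.gen x) ≤ C) :
    CStarSeminorm (FreeStarAlgebra X) :=
  CStarSeminorm.sup (relationSeminorms R) (bddAbove_relationSeminorms R hR)

/-- The universal unital C*-algebra with generators `X` and relations `r = 0`, `r ∈ R`. -/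
abbrev UniversalCStarAlgebra (R : Set (FreeStarAlgebra X))
    (hR : ∀ x, ∃ C, ∀ p ∈ relationSeminorms R, p (FreeStarAlgebra.gen x) ≤ C) : Type u :=
  (universalNorm R hR).Compl

namespace UniversalCStarAlgebra

variable {R : Set (FreeStarAlgebra X)}
  (hR : ∀ x, ∃ C, ∀ p ∈ relationSeminorms R, p (FreeStarAlgebra.gen x) ≤ C)

theorem relation {r : FreeStarAlgebra X} (hr : r ∈ R) : (universalNorm R hR).ι r = 0 := by
  rw [← norm_le_zero_iff, CStarSeminorm.norm_ι]
  exact CStarSeminorm.sup_le _ le_rfl (fun p hp => (hp r hr).le)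

/-- The universal property. -/
noncomputable def lift {B : Type v} [CStarAlgebra B] (v : X → B)
    (hv : ∀ r ∈ R, FreeStarAlgebra.lift v r = 0) : UniversalCStarAlgebra R hR →⋆ₐ[ℂ] B :=
  CStarSeminorm.lift (FreeStarAlgebra.lift v) (fun x =>
    CStarSeminorm.le_sup (S := relationSeminorms R) _
      (p := CStarSeminorm.ofHom (FreeStarAlgebra.lift v))
      (fun r hr => by rw [CStarSeminorm.ofHom_apply, hv r hr, norm_zero]) x)

theorem lift_gen {B : Type v} [CStarAlgebra B] (v : X → B)
    (hv : ∀ r ∈ R, FreeStarAlgebra.lift v r = 0) (x : X) :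
    lift hR v hv ((universalNorm R hR).ι (FreeStarAlgebra.gen x)) = v x :=
  (CStarSeminorm.lift_ι _ _ _).trans (FreeStarAlgebra.lift_gen v x)

theorem adjoin_gen_dense :
    (StarAlgebra.adjoin ℂ (Set.range fun x =>
      (universalNorm R hR).ι (FreeStarAlgebra.gen x))).topologicalClosure = ⊤ := by
  refine top_le_iff.1 fun y _ => ?_
  have h : ∀ x : FreeStarAlgebra X, (universalNorm R hR).ι x ∈
      StarAlgebra.adjoin ℂ (Set.range fun x => (universalNorm R hR).ι (FreeStarAlgebra.gen x)) := by
    intro x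
    induction x using FreeStarAlgebra.gen_induction with
    | h1 a => rw [AlgHomClass.commutes]; exact algebraMap_mem _ a
    | hgen x => exact StarAlgebra.subset_adjoin ℂ _ ⟨x, rfl⟩
    | hstar x hx => rw [StarHomClass.map_star]; exact star_mem hx
    | hadd x y hx hy => rw [map_add]; exact add_mem hx hy
    | hmul x y hx hy => rw [map_mul]; exact mul_mem hx hy
  exact CStarSeminorm.compl_induction _ y (StarSubalgebra.isClosed_topologicalClosure _)
    (fun x => subset_closure (h x))

end UniversalCStarAlgebra

end Universal

/-! ### Quantum automorphism groups of graphs -/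

section Qut

/-- The defining relations of the quantum automorphism group of the graph `X` with vertex coloring
`c`, for a matrix `u` over a *-algebra: `u` is a magic unitary, it respects the edges of `X`, and it
respects the colors. -/
structure IsQuantumAut {V : Type u} [Fintype V] {K : Type v} (X : SimpleGraph V) (c : V → K)
    {A : Type*} [Ring A] [StarRing A] (w : V → V → A) : Prop where
  selfAdjoint : ∀ i j, star (w i j) = w i j
  idempotent : ∀ i j, w i j * w i j = w i j
  row_sum : ∀ i, ∑ k, w i k = 1
  col_sum : ∀ j, ∑ k, w k j = 1
  edge : ∀ i j k l, (X.Adj i k ∧ ¬ X.Adj j l ∨ ¬ X.Adj i k ∧ X.Adj j l) → w i j * w k l = 0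
  color : ∀ i j, c i ≠ c j → w i j = 0

variable {V : Type u} [Fintype V] {K : Type v} (X : SimpleGraph V) (c : V → K)

/-- The elements of the free *-algebra on the generators `u i j` that are set to zero in the
function algebra of the quantum automorphism group. -/
inductive QutRelation : FreeStarAlgebra (V × V) → Prop
  | selfAdjoint (i j : V) : QutRelation
      (star (FreeStarAlgebra.gen (i, j)) - FreeStarAlgebra.gen (i, j))
  | idempotent (i j : V) : QutRelation
      (FreeStarAlgebra.gen (i, j) * FreeStarAlgebra.gen (i, j) - FreeStarAlgebra.gen (i, j))
  | row_sum (i : V) : QutRelation (∑ k, FreeStarAlgebra.gen (i, k) - 1)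
  | col_sum (j : V) : QutRelation (∑ k, FreeStarAlgebra.gen (k, j) - 1)
  | edge (i j k l : V) (h : X.Adj i k ∧ ¬ X.Adj j l ∨ ¬ X.Adj i k ∧ X.Adj j l) : QutRelation
      (FreeStarAlgebra.gen (i, j) * FreeStarAlgebra.gen (k, l))
  | color (i j : V) (h : c i ≠ c j) : QutRelation (FreeStarAlgebra.gen (i, j))

theorem qutRelation_bounded (x : V × V) :
    ∃ C, ∀ p ∈ relationSeminorms {r | QutRelation X c r}, p (FreeStarAlgebra.gen x) ≤ C := by
  refine ⟨1, fun p hp => ?_⟩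
  obtain ⟨i, j⟩ := x
  set g : FreeStarAlgebra (V × V) := FreeStarAlgebra.gen (i, j) with hg
  have h1 : p (star g - g) = 0 := hp _ (.selfAdjoint i j)
  have h2 : p (g * g - g) = 0 := hp _ (.idempotent i j)
  have h3 : p (star g * g) ≤ p g := by
    have e : star g * g = (star g - g) * g + (g * g - g) + g := by noncomm_ring
    calc p (star g * g) ≤ p ((star g - g) * g) + p (g * g - g) + p g := by
          rw [e]
          exact (map_add_le_add p _ _).trans (add_le_add_left (map_add_le_add p _ _) _)
      _ ≤ p (star g - g) * p g + p (g * g - g) + p g := by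
          gcongr; exact p.mul_le _ _
      _ = p g := by rw [h1, h2]; ring
  nlinarith [p.sq_le g, p.nonneg g]

/-- The C*-algebra `C(Qut_c(X))`. -/
abbrev QutAlgebra : Type u :=
  UniversalCStarAlgebra {r | QutRelation X c r} (qutRelation_bounded X c)

namespace QutAlgebra

/-- The generators `u i j` of `C(Qut_c(X))`. -/
noncomputable def u (i j : V) : QutAlgebra X c :=
  (universalNorm {r | QutRelation X c r} (qutRelation_bounded X c)).ι (FreeStarAlgebra.gen (i, j))

theorem isQuantumAut_u : IsQuantumAut X c (u X c) where
  selfAdjoint i j := by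
    have := UniversalCStarAlgebra.relation (qutRelation_bounded X c) (.selfAdjoint i j)
    rwa [map_sub, StarHomClass.map_star, sub_eq_zero] at this
  idempotent i j := by
    have := UniversalCStarAlgebra.relation (qutRelation_bounded X c) (.idempotent i j)
    rwa [map_sub, map_mul, sub_eq_zero] at this
  row_sum i := by
    have := UniversalCStarAlgebra.relation (qutRelation_bounded X c) (.row_sum i)
    rwa [map_sub, map_sum, map_one, sub_eq_zero] at this
  col_sum j := by
    have := UniversalCStarAlgebra.relation (qutRelation_bounded X c) (.col_sum j)
    rwa [map_sub, map_sum, map_one, sub_eq_zero] at this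
  edge i j k l h := by
    have := UniversalCStarAlgebra.relation (qutRelation_bounded X c) (.edge i j k l h)
    rwa [map_mul] at this
  color i j h := UniversalCStarAlgebra.relation (qutRelation_bounded X c) (.color i j h)

variable {X c} in
theorem lift_relation {B : Type*} [CStarAlgebra B] {w : V → V → B} (hw : IsQuantumAut X c w)
    (r : FreeStarAlgebra (V × V)) (hr : r ∈ {r | QutRelation X c r}) :
    FreeStarAlgebra.lift (fun x : V × V => w x.1 x.2) r = 0 := by
  cases hr with
  | selfAdjoint i j =>
    simp [StarHomClass.map_star, FreeStarAlgebra.lift_gen, hw.selfAdjoint i j]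
  | idempotent i j => simp [FreeStarAlgebra.lift_gen, hw.idempotent i j]
  | row_sum i => simp [FreeStarAlgebra.lift_gen, hw.row_sum i]
  | col_sum j => simp [FreeStarAlgebra.lift_gen, hw.col_sum j]
  | edge i j k l h => simp [FreeStarAlgebra.lift_gen, hw.edge i j k l h]
  | color i j h => simp [FreeStarAlgebra.lift_gen, hw.color i j h]

variable {X c} in
/-- The universal property of `C(Qut_c(X))`. -/
noncomputable def lift {B : Type*} [CStarAlgebra B] {w : V → V → B} (hw : IsQuantumAut X c w) :
    QutAlgebra X c →⋆ₐ[ℂ] B :=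
  UniversalCStarAlgebra.lift (qutRelation_bounded X c) (fun x : V × V => w x.1 x.2)
    (lift_relation hw)

variable {X c} in
theorem lift_u {B : Type*} [CStarAlgebra B] {w : V → V → B} (hw : IsQuantumAut X c w) (i j : V) :
    lift hw (u X c i j) = w i j :=
  UniversalCStarAlgebra.lift_gen _ _ _ _

theorem adjoin_u_dense :
    (StarAlgebra.adjoin ℂ {a | ∃ i j, a = u X c i j}).topologicalClosure = ⊤ := by
  rw [← UniversalCStarAlgebra.adjoin_gen_dense (qutRelation_bounded X c)]
  congr 2
  ext a
  constructor
  · rintro ⟨i, j, rfl⟩; exact ⟨(i, j), rfl⟩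
  · rintro ⟨⟨i, j⟩, rfl⟩; exact ⟨i, j, rfl⟩

end QutAlgebra

open scoped ComplexOrder in
/-- Projections in a C*-algebra that sum to `1` are mutually orthogonal. -/
theorem projections_orthogonal {A : Type*} [CStarAlgebra A] {ι : Type*} [Fintype ι] {q : ι → A}
    (hs : ∀ i, star (q i) = q i) (hi : ∀ i, q i * q i = q i) (h1 : ∑ i, q i = 1) {i j : ι}
    (hij : i ≠ j) : q i * q j = 0 := by
  classical
  let _ : PartialOrder A := CStarAlgebra.spectralOrder A
  let _ : StarOrderedRing A := CStarAlgebra.spectralOrderedRing A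
  have h2 : ∑ k ∈ Finset.univ.erase j, star (q k * q j) * (q k * q j) = 0 := by
    have h3 : ∀ k, star (q k * q j) * (q k * q j) = q j * q k * q j := fun k => by
      rw [star_mul, hs, hs, mul_assoc, ← mul_assoc (q k), hi, mul_assoc]
    have h4 : ∑ k, q j * q k * q j = q j := by
      rw [← Finset.sum_mul, ← Finset.mul_sum, h1, mul_one, hi]
    rw [← Finset.add_sum_erase _ _ (Finset.mem_univ j), hi, hi] at h4
    simp only [h3]
    exact left_eq_add.1 h4.symm
  have h5 := (Finset.sum_eq_zero_iff_of_nonneg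
    (fun k _ => star_mul_self_nonneg (q k * q j))).1 h2 i (by simp [hij])
  exact CStarRing.star_mul_self_eq_zero_iff _ |>.1 h5

variable {X c} in
/-- The matrix `∑ k, w i k ⊗ w k j` again satisfies the relations. -/
theorem IsQuantumAut.tensor {A : Type u} [CStarAlgebra A] {w : V → V → A}
    (hw : IsQuantumAut X c w) :
    IsQuantumAut X c (fun i j => ∑ k, MinTensor.tmul (w i k) (w k j)) := by
  have hmul : ∀ i j k l, (∑ m, MinTensor.tmul (w i m) (w m j)) *
      (∑ n, MinTensor.tmul (w k n) (w n l)) =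
      ∑ m, ∑ n, MinTensor.tmul (w i m * w k n) (w m j * w n l) := fun i j k l => by
    simp only [MinTensor.tmul, Finset.sum_mul_sum, ← map_mul, Algebra.TensorProduct.tmul_mul_tmul]
  have hz : ∀ a : A, MinTensor.tmul (0 : A) a = 0 := fun a => by simp [MinTensor.tmul]
  have hz' : ∀ a : A, MinTensor.tmul a (0 : A) = 0 := fun a => by simp [MinTensor.tmul]
  refine ⟨fun i j => ?_, fun i j => ?_, fun i => ?_, fun j => ?_, fun i j k l h => ?_,
    fun i j h => ?_⟩
  · simp only [MinTensor.tmul, star_sum, ← StarHomClass.map_star, TensorProduct.star_tmul,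
      hw.selfAdjoint]
  · rw [hmul]
    refine Finset.sum_congr rfl fun m _ => ?_
    rw [Finset.sum_eq_single m, hw.idempotent, hw.idempotent]
    · intro n _ hn
      rw [projections_orthogonal (hw.selfAdjoint i) (hw.idempotent i) (hw.row_sum i) hn.symm, hz]
    · simp
  · rw [Finset.sum_comm]
    simp only [MinTensor.tmul, ← map_sum, ← TensorProduct.tmul_sum, ← TensorProduct.sum_tmul,
      hw.row_sum]
    exact map_one (minNorm A A).ι
  · rw [Finset.sum_comm]
    simp only [MinTensor.tmul, ← map_sum, ← TensorProduct.sum_tmul, hw.col_sum,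
      ← TensorProduct.tmul_sum]
    exact map_one (minNorm A A).ι
  · rw [hmul]
    refine Finset.sum_eq_zero fun m _ => Finset.sum_eq_zero fun n _ => ?_
    by_cases hmn : X.Adj m n
    · rcases h with h | h
      · rw [hw.edge m j n l (Or.inl ⟨hmn, h.2⟩), hz']
      · rw [hw.edge i m k n (Or.inr ⟨h.1, hmn⟩), hz]
    · rcases h with h | h
      · rw [hw.edge i m k n (Or.inl ⟨h.1, hmn⟩), hz]
      · rw [hw.edge m j n l (Or.inr ⟨hmn, h.2⟩), hz']
  · refine Finset.sum_eq_zero fun m _ => ?_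
    by_cases hm : c i = c m
    · rw [hw.color m j (fun h' => h (hm.trans h')), hz']
    · rw [hw.color i m hm, hz]

end Qut

/-- A compact matrix quantum group: a unital C*-algebra generated by the entries of an invertible
matrix `u` whose entrywise adjoint is invertible too, with a comultiplication `Δ` that satisfies
`Δ (u i j) = ∑ k, u i k ⊗ u k j`. -/
structure CompactMatrixQuantumGroup where
  /-- The function algebra of the quantum group. -/
  Alg : Type u
  [cstar : CStarAlgebra Alg]
  /-- The index set of the fundamental representation. -/
  Index : Type u
  [fintype : Fintype Index]
  [decEq : DecidableEq Index]
  /-- The fundamental representation. -/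
  u : Matrix Index Index Alg
  dense : (StarAlgebra.adjoin ℂ {a | ∃ i j, a = u i j}).topologicalClosure = ⊤
  isUnit_u : IsUnit u
  isUnit_u_star : IsUnit (u.map star)
  /-- The comultiplication. -/
  Δ : Alg →⋆ₐ[ℂ] MinTensor Alg Alg
  Δ_u : ∀ i j, Δ (u i j) = ∑ k, MinTensor.tmul (u i k) (u k j)

attribute [instance] CompactMatrixQuantumGroup.cstar CompactMatrixQuantumGroup.fintype
  CompactMatrixQuantumGroup.decEq

/-- Two compact quantum groups are isomorphic if there is a *-isomorphism between their function
algebras that intertwines the comultiplications. -/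
def CompactMatrixQuantumGroup.Isomorphic (G H : CompactMatrixQuantumGroup.{u}) : Prop :=
  ∃ φ : G.Alg ≃⋆ₐ[ℂ] H.Alg, ∀ a : G.Alg,
    H.Δ (φ a) = MinTensor.map (φ : G.Alg →⋆ₐ[ℂ] H.Alg) (φ : G.Alg →⋆ₐ[ℂ] H.Alg) (G.Δ a)

section Qut

variable {V : Type u} [Fintype V]

variable {K : Type v} {X : SimpleGraph V} {c : V → K} in
open Classical in
theorem IsQuantumAut.isUnit {A : Type*} [CStarAlgebra A] {w : V → V → A}
    (hw : IsQuantumAut X c w) : IsUnit (Matrix.of w) := by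
  refine ⟨⟨Matrix.of w, (Matrix.of w).transpose, ?_, ?_⟩, rfl⟩
  · ext i j
    rw [Matrix.mul_apply, Matrix.one_apply]
    simp only [Matrix.transpose_apply, Matrix.of_apply]
    split_ifs with h
    · subst h; simp only [hw.idempotent, hw.row_sum]
    · exact Finset.sum_eq_zero fun k _ => projections_orthogonal (q := fun i => w i k)
        (fun i => hw.selfAdjoint i k) (fun i => hw.idempotent i k) (hw.col_sum k) h
  · ext i j
    rw [Matrix.mul_apply, Matrix.one_apply]
    simp only [Matrix.transpose_apply, Matrix.of_apply]
    split_ifs with h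
    · subst h; simp only [hw.idempotent, hw.col_sum]
    · exact Finset.sum_eq_zero fun k _ => projections_orthogonal (hw.selfAdjoint k)
        (hw.idempotent k) (hw.row_sum k) h

open Classical in
/-- The quantum automorphism group `Qut_c(X)` of a graph `X` with vertex coloring `c`. -/
noncomputable def QutColored {K : Type v} (X : SimpleGraph V) (c : V → K) :
    CompactMatrixQuantumGroup.{u} where
  Alg := QutAlgebra X c
  Index := V
  u := Matrix.of (QutAlgebra.u X c)
  dense := QutAlgebra.adjoin_u_dense X c
  isUnit_u := (QutAlgebra.isQuantumAut_u X c).isUnit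
  isUnit_u_star := by
    convert (QutAlgebra.isQuantumAut_u X c).isUnit using 1
    ext i j
    exact (QutAlgebra.isQuantumAut_u X c).selfAdjoint i j
  Δ := QutAlgebra.lift (QutAlgebra.isQuantumAut_u X c).tensor
  Δ_u i j := QutAlgebra.lift_u _ i j

/-- The quantum automorphism group `Qut(X)` of an uncolored graph: all vertices get the same
color. -/
noncomputable def Qut (X : SimpleGraph V) : CompactMatrixQuantumGroup.{u} :=
  QutColored X (fun _ => ())

/-- The quantum automorphism group `Qut_r(T)` of a graph `T` with root `r`: the root gets one color
and all other vertices get another one. -/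
noncomputable def QutRooted (T : SimpleGraph V) (r : V) : CompactMatrixQuantumGroup.{u} :=
  QutColored T (fun x => x = r)

end Qut

/-! ### Rooted paths and the construction of the unrooted tree -/

section Trees

/-- The rooted graph `(T, r)` is a path rooted at one of its endpoints (the one-vertex graph
included). -/
def IsPathRootedAtEnd {V : Type u} (T : SimpleGraph V) (r : V) : Prop :=
  ∃ (n : ℕ) (e : T ≃g SimpleGraph.pathGraph (n + 1)), e r = 0

/-- The graph obtained from the disjoint union of two rooted graphs `(T, r)` and `(P, s)` by adding
a new vertex `none`, adjacent to `r` and `s` only. -/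
def joinRoots {V : Type u} {W : Type v} (T : SimpleGraph V) (r : V) (P : SimpleGraph W) (s : W) :
    SimpleGraph (Option (V ⊕ W)) where
  Adj
    | some (Sum.inl a), some (Sum.inl b) => T.Adj a b
    | some (Sum.inr a), some (Sum.inr b) => P.Adj a b
    | none, some (Sum.inl a) => a = r
    | some (Sum.inl a), none => a = r
    | none, some (Sum.inr a) => a = s
    | some (Sum.inr a), none => a = s
    | _, _ => False
  symm := ⟨by
    rintro (_ | a | a) (_ | b | b) h
    all_goals first | exact h | exact T.adj_symm h | exact P.adj_symm h⟩
  loopless := ⟨by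
    rintro (_ | a | a) h
    · exact h
    · exact T.irrefl h
    · exact P.irrefl h⟩

/-- The graph obtained from the rooted graph `(T, r)` and a path with `2 * |V(T)|` edges, rooted at
one of its endpoints, by adding a new vertex adjacent to the two roots only. -/
def attachLongPath {V : Type u} [Fintype V] (T : SimpleGraph V) (r : V) :
    SimpleGraph (Option (V ⊕ Fin (2 * Fintype.card V + 1))) :=
  joinRoots T r (SimpleGraph.pathGraph (2 * Fintype.card V + 1)) 0

end Trees

/-! Let `u` be the generating matrix of the quantum automorphism group of a connected graph.
Inserting `1 = ∑ m, u b m` along a walk shows that `u i j * u k l = 0` unless the distance from `i`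
to `k` equals that from `j` to `l` (`IsQuantumAut.mul_eq_zero_of_dist_ne`). Double counting then
gives `u i j = 0` unless `i` and `j` have spheres of equal size at every radius
(`IsQuantumAut.eq_zero_of_card_sphere_ne`).

Let `n` be the number of vertices of `T`, and let `z` be the far end of the attached path. Up to
radius `2 * n + 2`, the distance from `z` to `r`, every sphere around `z` has at most one vertex. A
vertex with the same sphere sizes has at most one neighbour, so it is `z` or lies in `T`. In `T` it
would have pairwise distinct distances to the vertices of `T`, with `r` the farthest, which makes
`T` a path ending at `r` (`eq_longPathEnd_of_card_sphere_eq`). Otherwise `u z z = 1`, and the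
distance from `z` is preserved. That distance isolates each vertex outside `T` and also `r`, so `u`
is the identity outside the `T`-block, and the `T`-block satisfies the rooted relations. Conversely,
a rooted quantum automorphism of `T` extends by the identity. The two universal homomorphisms are
mutually inverse and respect the comultiplications (`QutColored.isomorphic_of_extension`).

If `T` is a path ending at `r`, the coloring fixes `r` and the distances from `r` are distinct, so
`u` is the identity matrix and the quantum group is trivial, as for the one-vertex graph. -/

namespace SimpleGraph

/-! ### Distances, paths and edge counts -/

/-- A function that vanishes only at `a`, grows by at most one along edges and decreases along some
edge from every vertex where it is positive is the distance from `a`. -/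
theorem dist_eq_of_forall_adj {V : Type*} {G : SimpleGraph V} {a : V} {h : V → ℕ}
    (h0 : ∀ b, h b = 0 ↔ b = a) (h1 : ∀ b c, G.Adj b c → h c ≤ h b + 1)
    (h2 : ∀ b m, h b = m + 1 → ∃ c, G.Adj c b ∧ h c = m) (b : V) : G.dist a b = h b := by
  have hle : ∀ m b, h b = m → ∃ p : G.Walk a b, p.length = m := by
    intro m
    induction m with
    | zero =>
      intro b hb
      obtain rfl := (h0 b).1 hb
      exact ⟨.nil, rfl⟩
    | succ m ih =>
      intro b hb
      obtain ⟨c, hc, hm⟩ := h2 b m hb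
      obtain ⟨p, hp⟩ := ih c hm
      exact ⟨p.concat hc, by simp [hp]⟩
  -- The growth bound along edges adds up along walks, so no walk from `a` to `b` is shorter than `h
  -- b`.
  have hge : ∀ {x y} (p : G.Walk x y), h y ≤ h x + p.length := by
    intro x y p
    induction p with
    | nil => simp
    | cons hxy p ih =>
      have := h1 _ _ hxy
      rw [Walk.length_cons]
      omega
  obtain ⟨p, hp⟩ := hle _ b rfl
  refine le_antisymm (hp ▸ dist_le p) ?_
  obtain ⟨q, hq⟩ := p.reachable.exists_walk_length_eq_dist
  rw [← hq]
  simpa [(h0 a).2 rfl] using hge q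

/-- Take the vertex after `b` on a shortest walk back to `a`; the triangle inequality keeps it from
being closer still. -/
theorem Connected.exists_adj_dist_eq {V : Type*} {G : SimpleGraph V} (hG : G.Connected) {a b : V}
    {m : ℕ} (h : G.dist a b = m + 1) : ∃ c, G.Adj c b ∧ G.dist a c = m := by
  obtain ⟨p, hp⟩ := hG.exists_walk_length_eq_dist b a
  rw [dist_comm, h] at hp
  cases p with
  | nil => simp at hp
  | @cons _ c _ hbc p =>
    refine ⟨c, hbc.symm, le_antisymm ?_ ?_⟩
    · rw [dist_comm]
      exact (dist_le p).trans (by simpa using hp.le)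
    · have h1 := hG.dist_triangle (u := a) (v := c) (w := b)
      rw [h, dist_eq_one_iff_adj.2 hbc.symm] at h1
      omega

theorem Connected.dist_le_dist_add_one {V : Type*} {G : SimpleGraph V} (hG : G.Connected) (a : V)
    {b c : V} (h : G.Adj b c) : G.dist a c ≤ G.dist a b + 1 := by
  have h1 := hG.dist_triangle (u := a) (v := b) (w := c)
  rwa [dist_eq_one_iff_adj.2 h] at h1

theorem Connected.dist_lt_card {V : Type*} [Fintype V] {G : SimpleGraph V} (hG : G.Connected)
    (a b : V) : G.dist a b < Fintype.card V := by
  obtain ⟨p, hp, h⟩ := hG.exists_path_of_dist a b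
  exact h ▸ hp.length_lt

/-- A connected graph in which the distances from `a` are pairwise distinct is a path, and its
other endpoint is at maximal distance from `a`. -/
theorem Connected.isPathRootedAtEnd {V : Type u} [Fintype V] {G : SimpleGraph V}
    (hG : G.Connected) {a r : V} (hinj : Function.Injective (G.dist a))
    (hr : ∀ b, G.dist a b ≠ G.dist a r + 1) : IsPathRootedAtEnd G r := by
  obtain ⟨n, hn⟩ : ∃ n, Fintype.card V = n + 1 :=
    Nat.exists_eq_succ_of_ne_zero (Fintype.card_pos_iff.2 ⟨a⟩).ne'
  have hlt : ∀ b, G.dist a b < n + 1 := fun b => hn ▸ hG.dist_lt_card a b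
  let f : V → Fin (n + 1) := fun b => ⟨G.dist a b, hlt b⟩
  have hf : Function.Bijective f := by
    refine (Fintype.bijective_iff_injective_and_card f).2 ⟨fun b c h => ?_, by simp [hn]⟩
    exact hinj (by simpa [f] using h)
  -- Some neighbour of `c` lies one step closer to `a`; by injectivity it can only be `b`.
  have key : ∀ b c, G.dist a b + 1 = G.dist a c → G.Adj b c := by
    intro b c h
    obtain ⟨d, hd, hd'⟩ := hG.exists_adj_dist_eq h.symm
    rwa [← hinj hd']
  -- The order is reversed because the prescribed endpoint `r` is the farthest vertex from `a` and
  -- must be sent to `0`.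
  let e : V ≃ Fin (n + 1) := (Equiv.ofBijective f hf).trans Fin.revPerm
  have he : ∀ b, (e b : ℕ) = n - G.dist a b := fun b => by
    simp [e, f, Fin.val_rev]
  refine ⟨n, ⟨e, ?_⟩, ?_⟩
  · intro b c
    have hb := hlt b
    have hc := hlt c
    rw [pathGraph_adj, he, he]
    constructor
    · rintro (h | h)
      · exact (key c b (by omega)).symm
      · exact key b c (by omega)
    · intro h
      have h1 := hG.dist_le_dist_add_one a h
      have h2 := hG.dist_le_dist_add_one a h.symm
      have h3 : G.dist a b ≠ G.dist a c := fun h' => h.ne (hinj h')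
      omega
  · change e r = 0
    apply Fin.ext
    rw [he, Fin.val_zero]
    by_contra h
    -- If `r` were not at the maximal distance `n`, surjectivity would give a vertex one step
    -- farther.
    obtain ⟨b, hb⟩ := hf.2 ⟨G.dist a r + 1, by omega⟩
    exact hr b (congrArg Fin.val hb)

/-- Every edge joins some `i` to its successor, so there are at most `n` edges; connectedness forces
at least `n`. -/
theorem isTree_pathGraph (n : ℕ) : (pathGraph (n + 1)).IsTree := by
  refine isTree_iff_connected_and_card.2 ⟨pathGraph_connected n, le_antisymm ?_ ?_⟩
  · have hsub : (pathGraph (n + 1)).edgeSet ⊆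
        Set.range fun i : Fin n => s(i.castSucc, i.succ) := by
      intro e
      induction e with | _ a b
      rw [mem_edgeSet, pathGraph_adj]
      rintro (h | h)
      · refine ⟨⟨a, by omega⟩, ?_⟩
        rw [Sym2.eq_iff]
        exact Or.inl ⟨Fin.ext rfl, Fin.ext h⟩
      · refine ⟨⟨b, by omega⟩, ?_⟩
        rw [Sym2.eq_iff]
        exact Or.inr ⟨Fin.ext rfl, Fin.ext h⟩
    have h1 : Nat.card (pathGraph (n + 1)).edgeSet ≤ n := by
      refine (Set.ncard_le_ncard hsub).trans ?_
      rw [← Set.image_univ]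
      refine (Set.ncard_image_le Set.finite_univ).trans ?_
      simp [Set.ncard_univ]
    simpa using h1
  · exact (pathGraph_connected n).card_vert_le_card_edgeSet_add_one

-- The handshake lemma as a double sum over vertices, a form that splits into blocks when the vertex
-- type is a disjoint union.
open Classical in
theorem sum_sum_adj_eq_two_mul_card {V : Type*} [Fintype V] (G : SimpleGraph V) :
    ∑ a, ∑ b, (if G.Adj a b then 1 else 0) = 2 * Nat.card G.edgeSet := by
  rw [Nat.card_eq_fintype_card, ← edgeFinset_card, ← sum_degrees_eq_twice_card_edges]
  refine Finset.sum_congr rfl fun a _ => ?_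
  rw [Finset.sum_boole, ← card_neighborFinset_eq_degree, neighborFinset_eq_filter]
  simp

end SimpleGraph

/-! ### Joining two rooted graphs through a new vertex -/

section JoinRoots

variable {V : Type u} {W : Type v} {T : SimpleGraph V} {r : V} {P : SimpleGraph W} {s : W}

theorem joinRoots_adj_inl_inl {a b : V} :
    (joinRoots T r P s).Adj (some (.inl a)) (some (.inl b)) ↔ T.Adj a b := Iff.rfl

theorem joinRoots_adj_inr_inr {a b : W} :
    (joinRoots T r P s).Adj (some (.inr a)) (some (.inr b)) ↔ P.Adj a b := Iff.rfl

theorem joinRoots_adj_none_inl {a : V} :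
    (joinRoots T r P s).Adj none (some (.inl a)) ↔ a = r := Iff.rfl

theorem joinRoots_adj_inl_none {a : V} :
    (joinRoots T r P s).Adj (some (.inl a)) none ↔ a = r := Iff.rfl

theorem joinRoots_adj_none_inr {a : W} :
    (joinRoots T r P s).Adj none (some (.inr a)) ↔ a = s := Iff.rfl

theorem joinRoots_adj_inr_none {a : W} :
    (joinRoots T r P s).Adj (some (.inr a)) none ↔ a = s := Iff.rfl

theorem joinRoots_adj_inl_inr {a : V} {b : W} :
    (joinRoots T r P s).Adj (some (.inl a)) (some (.inr b)) ↔ False := Iff.rfl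

theorem joinRoots_adj_inr_inl {a : V} {b : W} :
    (joinRoots T r P s).Adj (some (.inr b)) (some (.inl a)) ↔ False := Iff.rfl

theorem joinRoots_adj_none_none : (joinRoots T r P s).Adj none none ↔ False := Iff.rfl

theorem joinRoots_connected (hT : T.Connected) (hP : P.Connected) :
    (joinRoots T r P s).Connected := by
  let f : T →g joinRoots T r P s := ⟨fun a => some (.inl a), fun h => h⟩
  let g : P →g joinRoots T r P s := ⟨fun a => some (.inr a), fun h => h⟩
  have key : ∀ x, (joinRoots T r P s).Reachable none x := by
    rintro (_ | a | a)
    · exact .refl _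
    · have h : (joinRoots T r P s).Adj none (f r) := joinRoots_adj_none_inl.2 rfl
      exact h.reachable.trans ((hT.preconnected r a).map f)
    · have h : (joinRoots T r P s).Adj none (g s) := joinRoots_adj_none_inr.2 rfl
      exact h.reachable.trans ((hP.preconnected s a).map g)
  have : Nonempty (Option (V ⊕ W)) := ⟨none⟩
  exact ⟨fun x y => (key x).symm.trans (key y)⟩

theorem joinRoots_isTree [Fintype V] [Fintype W] (hT : T.IsTree) (hP : P.IsTree) :
    (joinRoots T r P s).IsTree := by
  classical
  refine SimpleGraph.isTree_iff_connected_and_card.2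
    ⟨joinRoots_connected hT.connected hP.connected, ?_⟩
  have h1 := (SimpleGraph.isTree_iff_connected_and_card.1 hT).2
  have h2 := (SimpleGraph.isTree_iff_connected_and_card.1 hP).2
  have h3 := SimpleGraph.sum_sum_adj_eq_two_mul_card (joinRoots T r P s)
  -- The adjacency matrix splits into the blocks of `T` and `P` and four further ones, for the two
  -- new edges. Hence the edge count is that of `T` plus that of `P` plus two.
  simp only [Fintype.sum_option, Fintype.sum_sum_type, joinRoots_adj_inl_inl,
    joinRoots_adj_inl_inr, joinRoots_adj_inl_none, joinRoots_adj_inr_inl, joinRoots_adj_inr_inr,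
    joinRoots_adj_inr_none, joinRoots_adj_none_inl, joinRoots_adj_none_inr,
    joinRoots_adj_none_none, Finset.sum_add_distrib, if_false, Finset.sum_const_zero,
    Finset.sum_ite_eq', Finset.mem_univ, if_true, SimpleGraph.sum_sum_adj_eq_two_mul_card] at h3
  rw [Nat.card_eq_fintype_card] at h1 h2 ⊢
  simp only [Nat.card_eq_fintype_card, Fintype.card_option, Fintype.card_sum] at h1 h2 h3 ⊢
  omega

end JoinRoots

/-! ### Distances and spheres in the tree with the attached path -/

section AttachLongPath

variable {V : Type u} [Fintype V] {T : SimpleGraph V} {r : V}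

theorem attachLongPath_connected (hT : T.Connected) : (attachLongPath T r).Connected :=
  joinRoots_connected hT (SimpleGraph.pathGraph_connected _)

theorem attachLongPath_isTree (hT : T.IsTree) : (attachLongPath T r).IsTree :=
  joinRoots_isTree hT (SimpleGraph.isTree_pathGraph _)

/-- The endpoint of the attached path that is farther from `T`. -/
def longPathEnd (V : Type u) [Fintype V] : Option (V ⊕ Fin (2 * Fintype.card V + 1)) :=
  some (.inr (Fin.last _))

/-- These values are pairwise distinct outside `T`, and on `T` they are a shift of the distance from
`r`. The subtraction never truncates, as `i ≤ 2 * Fintype.card V`. -/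
theorem attachLongPath_dist_end (hT : T.Connected) (x) :
    (attachLongPath T r).dist (longPathEnd V) x = match x with
      | some (.inl a) => T.dist r a + 2 * Fintype.card V + 2
      | none => 2 * Fintype.card V + 1
      | some (.inr i) => 2 * Fintype.card V - i := by
  refine SimpleGraph.dist_eq_of_forall_adj (G := attachLongPath T r) (a := longPathEnd V)
    (h := fun x => match x with
      | some (.inl a) => T.dist r a + 2 * Fintype.card V + 2
      | none => 2 * Fintype.card V + 1
      | some (.inr i) => 2 * Fintype.card V - i) ?_ ?_ ?_ x
  · rintro (_ | a | i) <;> simp [longPathEnd, Fin.ext_iff]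
    omega
  · rintro (_ | a | i) (_ | b | j) h
    · simp
    · obtain rfl := joinRoots_adj_none_inl.1 h
      simp
    · dsimp only; omega
    · dsimp only; omega
    · have := hT.dist_le_dist_add_one r (joinRoots_adj_inl_inl.1 h)
      dsimp only; omega
    · exact h.elim
    · obtain rfl := joinRoots_adj_inr_none.1 h
      simp
    · exact h.elim
    · have := SimpleGraph.pathGraph_adj.1 (joinRoots_adj_inr_inr.1 h)
      dsimp only; omega
  · rintro (_ | a | i) m h
    · exact ⟨some (.inr 0), joinRoots_adj_inr_none.2 rfl, by simpa using h⟩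
    · dsimp only at h
      rcases Nat.eq_zero_or_pos (T.dist r a) with h0 | h0
      · obtain rfl := hT.dist_eq_zero_iff.1 h0
        exact ⟨none, joinRoots_adj_none_inl.2 rfl, by dsimp only; omega⟩
      · obtain ⟨k, hk⟩ := Nat.exists_eq_succ_of_ne_zero h0.ne'
        obtain ⟨c, hc, hc'⟩ := hT.exists_adj_dist_eq hk
        exact ⟨some (.inl c), joinRoots_adj_inl_inl.2 hc, by dsimp only; omega⟩
    · dsimp only at h
      refine ⟨some (.inr ⟨i + 1, by omega⟩),
        joinRoots_adj_inr_inr.2 (SimpleGraph.pathGraph_adj.2 (Or.inr rfl)), ?_⟩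
      dsimp only; omega

/-- A walk that leaves `T` must do so through `r`, and distances inside `T` do not change. This
serves to rule out that `v` has the same sphere sizes as the far end. -/
theorem attachLongPath_dist_inl (hT : T.Connected) (v : V) (x) :
    (attachLongPath T r).dist (some (.inl v)) x = match x with
      | some (.inl a) => T.dist v a
      | none => T.dist v r + 1
      | some (.inr i) => T.dist v r + 2 + i := by
  refine SimpleGraph.dist_eq_of_forall_adj (G := attachLongPath T r) (a := some (.inl v))
    (h := fun x => match x with
      | some (.inl a) => T.dist v a
      | none => T.dist v r + 1
      | some (.inr i) => T.dist v r + 2 + i) ?_ ?_ ?_ x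
  · rintro (_ | a | i) <;> simp [hT.preconnected _ _, @eq_comm _ v]
  · rintro (_ | a | i) (_ | b | j) h
    · simp
    · obtain rfl := joinRoots_adj_none_inl.1 h
      dsimp only; omega
    · obtain rfl := joinRoots_adj_none_inr.1 h
      simp
    · obtain rfl := joinRoots_adj_inl_none.1 h
      simp
    · exact hT.dist_le_dist_add_one v (joinRoots_adj_inl_inl.1 h)
    · exact h.elim
    · dsimp only; omega
    · exact h.elim
    · have := SimpleGraph.pathGraph_adj.1 (joinRoots_adj_inr_inr.1 h)
      dsimp only; omega
  · rintro (_ | a | i) m h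
    · exact ⟨some (.inl r), joinRoots_adj_inl_none.2 rfl, by simpa using h⟩
    · obtain ⟨c, hc, hc'⟩ := hT.exists_adj_dist_eq h
      exact ⟨some (.inl c), joinRoots_adj_inl_inl.2 hc, hc'⟩
    · dsimp only at h
      rcases Nat.eq_zero_or_pos (i : ℕ) with h0 | h0
      · exact ⟨none, joinRoots_adj_none_inr.2 (Fin.ext h0), by dsimp only; omega⟩
      · refine ⟨some (.inr ⟨i - 1, by omega⟩),
          joinRoots_adj_inr_inr.2 (SimpleGraph.pathGraph_adj.2 (Or.inl ?_)), ?_⟩ <;>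
        dsimp only <;> omega

/-- If `T` is not a path rooted at `r`, then the end of the attached path is distinguished from all
other vertices by the sizes of the spheres around it. -/
theorem eq_longPathEnd_of_card_sphere_eq (hT : T.Connected) (hr : ¬ IsPathRootedAtEnd T r)
    {y : Option (V ⊕ Fin (2 * Fintype.card V + 1))}
    (hy : ∀ m, ({k | (attachLongPath T r).dist y k = m} : Finset _).card =
      ({k | (attachLongPath T r).dist (longPathEnd V) k = m} : Finset _).card) :
    y = longPathEnd V := by
  -- The bound is the distance from the far end to `r`, before which `T` cannot branch. Only radii
  -- up to `Fintype.card V` are used below.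
  have hz : ∀ m ≤ 2 * Fintype.card V + 2, ∀ k l, (attachLongPath T r).dist y k = m →
      (attachLongPath T r).dist y l = m → k = l := by
    intro m hm k l hk hl
    have h1 : ({k | (attachLongPath T r).dist (longPathEnd V) k = m} : Finset _).card ≤ 1 := by
      refine Finset.card_le_one.2 fun k hk l hl => ?_
      simp only [Finset.mem_filter, Finset.mem_univ, true_and, attachLongPath_dist_end hT] at hk hl
      rcases k with (_ | a | i) <;> rcases l with (_ | b | j) <;> dsimp only at hk hl
      any_goals omega
      · rfl
      · rw [← hT.dist_eq_zero_iff.1 (show T.dist r a = 0 by omega),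
          ← hT.dist_eq_zero_iff.1 (show T.dist r b = 0 by omega)]
      · rw [Fin.ext (show (i : ℕ) = j by omega)]
    rw [← hy] at h1
    exact Finset.card_le_one.1 h1 k (by simpa using hk) l (by simpa using hl)
  -- Radius one: `y` has at most one neighbour, which excludes the new vertex and every path vertex
  -- except the far end.
  have hadj : ∀ k l, (attachLongPath T r).Adj y k → (attachLongPath T r).Adj y l → k = l :=
    fun k l hk hl => hz 1 (by omega) k l (SimpleGraph.dist_eq_one_iff_adj.2 hk)
      (SimpleGraph.dist_eq_one_iff_adj.2 hl)
  rcases y with (_ | v | i)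
  · have := hadj (some (.inl r)) (some (.inr 0)) (joinRoots_adj_none_inl.2 rfl)
      (joinRoots_adj_none_inr.2 rfl)
    simp at this
  -- Distances inside `T` are below `Fintype.card V`, hence within the range of `hz`, and so they
  -- are distinct. The new vertex already occupies distance `T.dist v r + 1`, so no vertex of `T`
  -- lies there and `r` is the far endpoint.
  · have hlt := hT.dist_lt_card v
    refine absurd (hT.isPathRootedAtEnd (a := v) (fun a b hab => ?_) (fun b hb => ?_)) hr
    · have := hz (T.dist v b) (by have := hlt b; omega) (some (.inl a)) (some (.inl b))
        (by simpa [attachLongPath_dist_inl hT] using hab) (by simp [attachLongPath_dist_inl hT])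
      simpa using this
    · have := hz (T.dist v r + 1) (by have := hlt r; omega) (some (.inl b)) none
        (by simpa [attachLongPath_dist_inl hT] using hb) (by simp [attachLongPath_dist_inl hT])
      simp at this
  · by_contra hi
    have hi' : (i : ℕ) ≠ 2 * Fintype.card V := fun h => hi (by
      rw [longPathEnd, show i = Fin.last _ from Fin.ext h])
    have h1 : (attachLongPath T r).Adj (some (.inr i)) (some (.inr ⟨i + 1, by omega⟩)) :=
      joinRoots_adj_inr_inr.2 (SimpleGraph.pathGraph_adj.2 (Or.inl rfl))
    rcases Nat.eq_zero_or_pos (i : ℕ) with h0 | h0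
    · have := hadj _ none h1 (joinRoots_adj_inr_none.2 (Fin.ext h0))
      simp at this
    · have := hadj _ (some (.inr ⟨i - 1, by omega⟩)) h1 (joinRoots_adj_inr_inr.2
        (SimpleGraph.pathGraph_adj.2 (Or.inr (by dsimp only; omega))))
      simp only [Option.some.injEq, Sum.inr.injEq, Fin.mk.injEq] at this
      omega

end AttachLongPath

/-! ### Quantum automorphisms and distances -/

namespace IsQuantumAut

section

variable {V : Type u} [Fintype V] {K : Type v} {X : SimpleGraph V} {c : V → K} {A : Type*}
  [CStarAlgebra A] {w : V → V → A}

/-- The relations treat rows and columns alike, so each one-sided vanishing statement also yields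
its mirror image. -/
theorem transpose (hw : IsQuantumAut X c w) : IsQuantumAut X c (fun i j => w j i) where
  selfAdjoint i j := hw.selfAdjoint j i
  idempotent i j := hw.idempotent j i
  row_sum i := hw.col_sum i
  col_sum j := hw.row_sum j
  edge i j k l h := hw.edge j i l k (by tauto)
  color i j h := hw.color j i h.symm

theorem mul_eq_zero_of_ne (hw : IsQuantumAut X c w) (i : V) {j k : V} (h : j ≠ k) :
    w i j * w i k = 0 :=
  projections_orthogonal (hw.selfAdjoint i) (hw.idempotent i) (hw.row_sum i) h

/-- Insert `∑ m, w b m = 1` for the second vertex `b` of the walk. If `m` is not adjacent to `j`,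
the edge relation kills the term; otherwise `m` is at most one step closer to `l` than `j` is, and
induction applies. For the empty walk this is orthogonality within a row. -/
theorem mul_eq_zero_of_length_lt_dist (hw : IsQuantumAut X c w) (hX : X.Connected) {i k : V}
    (p : X.Walk i k) (j l : V) (h : p.length < X.dist j l) : w i j * w k l = 0 := by
  induction p generalizing j with
  | nil => exact hw.mul_eq_zero_of_ne _ fun h' => by simp [h'] at h
  | @cons a b d hab p ih =>
    rw [SimpleGraph.Walk.length_cons] at h
    rw [← mul_one (w a j), ← hw.row_sum b, Finset.mul_sum, Finset.sum_mul]
    refine Finset.sum_eq_zero fun m _ => ?_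
    by_cases hm : X.Adj j m
    · have := hX.dist_triangle (u := j) (v := m) (w := l)
      rw [SimpleGraph.dist_eq_one_iff_adj.2 hm] at this
      rw [mul_assoc, ih m (by omega), mul_zero]
    · rw [hw.edge a j b m (Or.inl ⟨hab, hm⟩), zero_mul]

/-- A quantum automorphism of a connected graph preserves distances. -/
theorem mul_eq_zero_of_dist_ne (hw : IsQuantumAut X c w) (hX : X.Connected) {i j k l : V}
    (h : X.dist i k ≠ X.dist j l) : w i j * w k l = 0 := by
  rcases h.lt_or_gt with h | h
  · obtain ⟨p, hp⟩ := hX.exists_walk_length_eq_dist i k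
    exact hw.mul_eq_zero_of_length_lt_dist hX p j l (hp ▸ h)
  · obtain ⟨p, hp⟩ := hX.exists_walk_length_eq_dist j l
    exact hw.transpose.mul_eq_zero_of_length_lt_dist hX p i k (hp ▸ h)

/-- Sum `w i j * w k l` over `k` in the sphere around `i` and `l` in the sphere around `j`. Since
distances are preserved, each inner sum may be extended to a full row or column and equals `w i j`;
the two orders of summation give `w i j` times either cardinality. -/
theorem eq_zero_of_card_sphere_ne (hw : IsQuantumAut X c w) (hX : X.Connected) {i j : V} {m : ℕ}
    (h : ({k | X.dist i k = m} : Finset V).card ≠ ({k | X.dist j k = m} : Finset V).card) :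
    w i j = 0 := by
  have h1 : ∀ k, X.dist i k = m → ∑ l with X.dist j l = m, w i j * w k l = w i j := by
    intro k hk
    rw [Finset.sum_filter_of_ne fun l _ hl => ?_, ← Finset.mul_sum, hw.row_sum, mul_one]
    by_contra h'
    exact hl (hw.mul_eq_zero_of_dist_ne hX (by rw [hk]; exact Ne.symm h'))
  have h2 : ∀ l, X.dist j l = m → ∑ k with X.dist i k = m, w i j * w k l = w i j := by
    intro l hl
    rw [Finset.sum_filter_of_ne fun k _ hk => ?_, ← Finset.mul_sum, hw.col_sum, mul_one]
    by_contra h'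
    exact hk (hw.mul_eq_zero_of_dist_ne hX (by rw [hl]; exact h'))
  have h3 : ({k | X.dist i k = m} : Finset V).card • w i j =
      ({l | X.dist j l = m} : Finset V).card • w i j := by
    rw [← Finset.sum_const, ← Finset.sum_const]
    calc ∑ k with X.dist i k = m, w i j
        = ∑ k with X.dist i k = m, ∑ l with X.dist j l = m, w i j * w k l :=
          Finset.sum_congr rfl fun k hk => (h1 k (Finset.mem_filter.1 hk).2).symm
      _ = ∑ l with X.dist j l = m, ∑ k with X.dist i k = m, w i j * w k l := Finset.sum_comm
      _ = ∑ l with X.dist j l = m, w i j :=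
          Finset.sum_congr rfl fun l hl => h2 l (Finset.mem_filter.1 hl).2
  rw [← Nat.cast_smul_eq_nsmul ℂ, ← Nat.cast_smul_eq_nsmul ℂ, ← sub_eq_zero, ← sub_smul,
    smul_eq_zero] at h3
  exact h3.resolve_left (sub_ne_zero.2 (Nat.cast_injective.ne h))

theorem self_eq_one (hw : IsQuantumAut X c w) {i : V} (h : ∀ j, j ≠ i → w i j = 0) :
    w i i = 1 := by
  rw [← hw.row_sum i, Finset.sum_eq_single i (fun j _ hj => h j hj) (by simp)]

/-- A quantum automorphism that fixes `a` preserves the distance from `a`. -/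
theorem eq_zero_of_dist_ne (hw : IsQuantumAut X c w) (hX : X.Connected) {a : V} (ha : w a a = 1)
    {i j : V} (h : X.dist a i ≠ X.dist a j) : w i j = 0 := by
  -- Write `w i j` as `w a a * w i j`.
  rw [← one_mul (w i j), ← ha, hw.mul_eq_zero_of_dist_ne hX h]

end

end IsQuantumAut

/-! ### Homomorphisms, tensor products and isomorphisms of quantum groups -/

theorem continuous_starAlgHom {A B : Type*} [CStarAlgebra A] [CStarAlgebra B] (f : A →⋆ₐ[ℂ] B) :
    Continuous f :=
  AddMonoidHomClass.continuous_of_bound f 1 fun x => by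
    rw [one_mul]
    exact NonUnitalStarAlgHom.norm_apply_le f x

namespace MinTensor

variable {A B C D E F : Type u} [CStarAlgebra A] [CStarAlgebra B] [CStarAlgebra C] [CStarAlgebra D]
  [CStarAlgebra E] [CStarAlgebra F]

/-- Elementary tensors span a dense subspace, and *-homomorphisms of C*-algebras are continuous. -/
theorem ext_hom {f g : MinTensor A B →⋆ₐ[ℂ] C} (h : ∀ a b, f (tmul a b) = g (tmul a b))
    (x : MinTensor A B) : f x = g x := by
  refine CStarSeminorm.compl_induction _ (C := fun x => f x = g x) x
    (isClosed_eq (continuous_starAlgHom f) (continuous_starAlgHom g)) fun x => ?_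
  change f ((minNorm A B).ι x) = g ((minNorm A B).ι x)
  induction x using TensorProduct.induction_on with
  | zero => simp
  | add x y hx hy => simp only [map_add, hx, hy]
  | tmul a b => exact h a b

theorem map_map (φ' : C →⋆ₐ[ℂ] E) (ψ' : D →⋆ₐ[ℂ] F) (φ : A →⋆ₐ[ℂ] C) (ψ : B →⋆ₐ[ℂ] D)
    (x : MinTensor A B) : map φ' ψ' (map φ ψ x) = map (φ'.comp φ) (ψ'.comp ψ) x :=
  ext_hom (f := (map φ' ψ').comp (map φ ψ)) (fun a b => by
    simp only [StarAlgHom.comp_apply, map_tmul]) x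

theorem map_id (x : MinTensor A B) : map (.id ℂ A) (.id ℂ B) x = x :=
  ext_hom (g := .id ℂ _) (fun a b => by
    simp only [StarAlgHom.coe_id, id, map_tmul]) x

end MinTensor

/-- By functoriality of `MinTensor.map`, the inverse on both tensor factors cancels the original
map. -/
theorem CompactMatrixQuantumGroup.Isomorphic.symm {G H : CompactMatrixQuantumGroup.{u}}
    (h : G.Isomorphic H) : H.Isomorphic G := by
  obtain ⟨φ, hφ⟩ := h
  refine ⟨φ.symm, fun a => ?_⟩
  have h1 := hφ (φ.symm a)
  rw [StarAlgEquiv.apply_symm_apply] at h1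
  have h2 : ((φ.symm : H.Alg →⋆ₐ[ℂ] G.Alg)).comp (φ : G.Alg →⋆ₐ[ℂ] H.Alg) = .id ℂ _ :=
    StarAlgHom.ext fun x => φ.symm_apply_apply x
  rw [h1, MinTensor.map_map, h2, MinTensor.map_id]

section

variable {V : Type u} [Fintype V] {K : Type v} {X : SimpleGraph V} {c : V → K}

/-- The equalizer is a closed *-subalgebra, and the generators generate a dense one. -/
theorem QutAlgebra.hom_ext {B : Type*} [CStarAlgebra B] {f g : QutAlgebra X c →⋆ₐ[ℂ] B}
    (h : ∀ i j, f (QutAlgebra.u X c i j) = g (QutAlgebra.u X c i j)) (x) : f x = g x := by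
  have h1 : x ∈ (StarAlgebra.adjoin ℂ {a | ∃ i j, a = QutAlgebra.u X c i j}).topologicalClosure :=
    QutAlgebra.adjoin_u_dense X c ▸ StarSubalgebra.mem_top
  refine closure_minimal (t := {x | f x = g x}) (fun y hy => ?_)
    (isClosed_eq (continuous_starAlgHom f) (continuous_starAlgHom g)) h1
  refine StarAlgebra.adjoin_le (S := StarAlgHom.equalizer f g) ?_ hy
  rintro _ ⟨i, j, rfl⟩
  exact h i j

/-- If the quantum automorphisms of `(Y, d)` are the extensions by the identity of those of
`(X, c)`, then the quantum automorphism groups agree. -/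
theorem QutColored.isomorphic_of_extension {W : Type u} [Fintype W] {L : Type*}
    {Y : SimpleGraph W} {d : W → L} {e : V → W} (he : Function.Injective e)
    (hres : IsQuantumAut X c (fun a b => QutAlgebra.u Y d (e a) (e b)))
    (hoff : ∀ a k, k ∉ Set.range e → QutAlgebra.u Y d (e a) k = 0)
    {w : W → W → QutAlgebra X c} (hw : IsQuantumAut Y d w)
    (hwe : ∀ a b, w (e a) (e b) = QutAlgebra.u X c a b)
    (hlift : ∀ i j, QutAlgebra.lift hres (w i j) = QutAlgebra.u Y d i j) :
    (QutColored X c).Isomorphic (QutColored Y d) := by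
  let ψ := QutAlgebra.lift hres
  let φ := QutAlgebra.lift hw
  have h1 : ∀ x, φ (ψ x) = x := QutAlgebra.hom_ext (f := φ.comp ψ) (g := .id ℂ _) fun a b => by
    rw [StarAlgHom.comp_apply, QutAlgebra.lift_u, QutAlgebra.lift_u, hwe, StarAlgHom.coe_id, id]
  have h2 : ∀ x, ψ (φ x) = x := QutAlgebra.hom_ext (f := ψ.comp φ) (g := .id ℂ _) fun i j => by
    rw [StarAlgHom.comp_apply, QutAlgebra.lift_u, hlift, StarAlgHom.coe_id, id]
  refine ⟨StarAlgEquiv.ofStarAlgHom ψ φ (StarAlgHom.ext h1) (StarAlgHom.ext h2), ?_⟩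
  -- Both sides of the intertwining relation are *-homomorphisms, so generators suffice. There the
  -- comultiplication of `Y` sums over all of `W`, and `hoff` removes the indices outside the range
  -- of `e`.
  refine QutAlgebra.hom_ext
    (f := (QutAlgebra.lift (QutAlgebra.isQuantumAut_u Y d).tensor).comp ψ)
    (g := (MinTensor.map ψ ψ).comp (QutAlgebra.lift (QutAlgebra.isQuantumAut_u X c).tensor))
    fun a b => ?_
  simp only [StarAlgHom.comp_apply, QutAlgebra.lift_u, ψ, map_sum, MinTensor.map_tmul]
  refine (Finset.sum_of_injOn e he.injOn (fun _ _ => Finset.mem_coe.2 (Finset.mem_univ _))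
    (fun k _ hk => ?_) (fun _ _ => rfl)).symm
  rw [hoff a k (by simpa using hk)]
  simp [MinTensor.tmul]

end

/-! ### Quantum automorphisms of the tree with the attached path -/

section AttachLongPath

variable {V : Type u} [Fintype V] {T : SimpleGraph V} {r : V}

namespace IsQuantumAut

section

variable {K : Type v} {c : Option (V ⊕ Fin (2 * Fintype.card V + 1)) → K} {A : Type*}
  [CStarAlgebra A] {w : Option (V ⊕ Fin (2 * Fintype.card V + 1)) →
    Option (V ⊕ Fin (2 * Fintype.card V + 1)) → A}

/-- Quantum automorphisms fix the end of the attached path, so they preserve the distance from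
it. -/
theorem eq_zero_of_dist_longPathEnd_ne (hw : IsQuantumAut (attachLongPath T r) c w)
    (hT : T.Connected) (hr : ¬ IsPathRootedAtEnd T r) {i j}
    (h : (attachLongPath T r).dist (longPathEnd V) i ≠
      (attachLongPath T r).dist (longPathEnd V) j) : w i j = 0 := by
  refine hw.eq_zero_of_dist_ne (attachLongPath_connected hT) (hw.self_eq_one fun k hk => ?_) h
  -- A nonzero entry in the row of the far end would force `k` to have the same sphere sizes.
  by_contra h0
  refine hk (eq_longPathEnd_of_card_sphere_eq hT hr fun m => ?_)
  by_contra hm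
  exact h0 (hw.eq_zero_of_card_sphere_ne (attachLongPath_connected hT) (Ne.symm hm))

/-- Vertices outside `T` have pairwise distinct distances from the far end, at most `2 *
Fintype.card V + 1`, while those of `T` are larger. So each vertex outside `T` is alone in its
sphere. -/
theorem attachLongPath_eq_zero (hw : IsQuantumAut (attachLongPath T r) c w)
    (hT : T.Connected) (hr : ¬ IsPathRootedAtEnd T r) {x}
    (hx : x ∉ Set.range fun a : V => some (Sum.inl a)) {y} (hxy : x ≠ y) :
    w x y = 0 ∧ w y x = 0 := by
  have h : (attachLongPath T r).dist (longPathEnd V) x ≠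
      (attachLongPath T r).dist (longPathEnd V) y := by
    rw [attachLongPath_dist_end hT, attachLongPath_dist_end hT]
    rcases x with (_ | a | i) <;> rcases y with (_ | b | j) <;> dsimp only
    any_goals omega
    · exact absurd rfl hxy
    · exact absurd ⟨a, rfl⟩ hx
    · intro h
      exact hxy (by rw [Fin.ext (show (i : ℕ) = j by omega)])
  exact ⟨hw.eq_zero_of_dist_longPathEnd_ne hT hr h,
    hw.eq_zero_of_dist_longPathEnd_ne hT hr h.symm⟩

/-- The entries linking `T` to its complement vanish, so the `T`-block has row and column sums `1`
by itself. It respects the root because `r` is the only vertex of `T` nearest to the far end. -/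
theorem restrict_attachLongPath (hw : IsQuantumAut (attachLongPath T r) c w)
    (hT : T.Connected) (hr : ¬ IsPathRootedAtEnd T r) :
    IsQuantumAut T (fun x => x = r) (fun a b => w (some (.inl a)) (some (.inl b))) where
  selfAdjoint i j := hw.selfAdjoint _ _
  idempotent i j := hw.idempotent _ _
  row_sum i := by
    have h : ∀ x, x ∉ Set.range (fun a : V => some (Sum.inl a)) → w (some (.inl i)) x = 0 :=
      fun x hx => (hw.attachLongPath_eq_zero hT hr hx fun h => hx ⟨i, h.symm⟩).2
    have h1 := hw.row_sum (some (.inl i))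
    rw [Fintype.sum_option, Fintype.sum_sum_type, h none (by simp), zero_add,
      Finset.sum_eq_zero (s := Finset.univ (α := Fin _)) fun x _ => h _ (by simp), add_zero] at h1
    exact h1
  col_sum i := by
    have h : ∀ x, x ∉ Set.range (fun a : V => some (Sum.inl a)) → w x (some (.inl i)) = 0 :=
      fun x hx => (hw.attachLongPath_eq_zero hT hr hx fun h => hx ⟨i, h.symm⟩).1
    have h1 := hw.col_sum (some (.inl i))
    rw [Fintype.sum_option, Fintype.sum_sum_type, h none (by simp), zero_add,
      Finset.sum_eq_zero (s := Finset.univ (α := Fin _)) fun x _ => h _ (by simp), add_zero] at h1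
    exact h1
  edge i j k l h := hw.edge _ _ _ _ h
  color i j h := by
    refine hw.eq_zero_of_dist_longPathEnd_ne hT hr fun h' => h (propext ?_)
    simp only [attachLongPath_dist_end hT] at h'
    have h'' : T.dist r i = T.dist r j := by omega
    rw [eq_comm, ← hT.dist_eq_zero_iff, h'', hT.dist_eq_zero_iff, eq_comm]

end

end IsQuantumAut

/-- The extension of a matrix indexed by `V` by the identity matrix. -/
def extendByOne {V W A : Type*} [DecidableEq W] [Zero A] [One A] (w : V → V → A) :
    Option (V ⊕ W) → Option (V ⊕ W) → A
  | some (.inl a), some (.inl b) => w a b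
  | none, none => 1
  | some (.inr i), some (.inr j) => if i = j then 1 else 0
  | _, _ => 0

/-- Only the edge from the new vertex to `r` links `T` to the added vertices, and the coloring
relation is exactly what makes the extended matrix respect it. -/
theorem IsQuantumAut.extendByOne {W : Type*} [Fintype W] [DecidableEq W] {P : SimpleGraph W}
    {s : W} {A : Type*} [Ring A] [StarRing A] {w : V → V → A}
    (hw : IsQuantumAut T (fun x => x = r) w) :
    IsQuantumAut (joinRoots T r P s) (fun _ => ()) (extendByOne (W := W) w) where
  selfAdjoint := by
    rintro (_ | a | i) (_ | b | j)
    any_goals first | exact star_zero _ | exact star_one _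
    · exact hw.selfAdjoint a b
    · simp only [_root_.extendByOne]; split_ifs <;> simp
  idempotent := by
    rintro (_ | a | i) (_ | b | j)
    any_goals first | exact mul_zero _ | exact mul_one _
    · exact hw.idempotent a b
    · simp only [_root_.extendByOne]; split_ifs <;> simp
  row_sum := by
    rintro (_ | a | i) <;>
      simp [Fintype.sum_option, Fintype.sum_sum_type, _root_.extendByOne, hw.row_sum]
  col_sum := by
    rintro (_ | a | i) <;>
      simp [Fintype.sum_option, Fintype.sum_sum_type, _root_.extendByOne, hw.col_sum]
  edge := by
    have hc : ∀ a b, ¬ (a = r ↔ b = r) → w a b = 0 := fun a b h =>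
      hw.color a b fun h' => h (iff_of_eq h')
    rintro (_ | a | i) (_ | b | j) (_ | a' | i') (_ | b' | j') h
    -- This leaves the nine pairs of diagonal blocks.
    any_goals first | exact mul_zero _ | exact zero_mul _
    all_goals
      simp only [joinRoots_adj_inl_inl, joinRoots_adj_inl_inr, joinRoots_adj_inl_none,
        joinRoots_adj_inr_inl, joinRoots_adj_inr_inr, joinRoots_adj_inr_none,
        joinRoots_adj_none_inl, joinRoots_adj_none_inr, joinRoots_adj_none_none] at h
      simp only [_root_.extendByOne]
    · tauto
    · rw [hc a' b' (by tauto), mul_zero]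
    · split_ifs with h1
      · subst h1; tauto
      · exact mul_zero _
    · rw [hc a b (by tauto), zero_mul]
    · exact hw.edge _ _ _ _ h
    · tauto
    · split_ifs with h1
      · subst h1; tauto
      · exact zero_mul _
    · tauto
    · split_ifs with h1 h2 h2
      · subst h1 h2; tauto
      all_goals simp
  color _ _ h := absurd rfl h

/-- Restricting to `T` and extending by the identity are mutually inverse, because the generating
matrix of the large tree is already the identity outside the `T`-block. -/
theorem qutRooted_isomorphic_qut_attachLongPath (hT : T.Connected) (hr : ¬ IsPathRootedAtEnd T r) :
    (QutRooted T r).Isomorphic (Qut (attachLongPath T r)) := by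
  have hu := QutAlgebra.isQuantumAut_u (attachLongPath T r) fun _ => ()
  refine QutColored.isomorphic_of_extension (e := fun a : V => some (Sum.inl a))
    (fun a b h => by simpa using h) (hu.restrict_attachLongPath hT hr)
    (fun a k hk => (hu.attachLongPath_eq_zero hT hr hk fun h => hk ⟨a, h.symm⟩).2)
    (w := extendByOne (QutAlgebra.u T fun x => x = r))
    (QutAlgebra.isQuantumAut_u T fun x => x = r).extendByOne (fun _ _ => rfl) ?_
  have h0 : ∀ x y, x ∉ Set.range (fun a : V => some (Sum.inl a)) → x ≠ y →
      QutAlgebra.u (attachLongPath T r) (fun _ => ()) x y = 0 ∧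
        QutAlgebra.u (attachLongPath T r) (fun _ => ()) y x = 0 :=
    fun x y hx hxy => hu.attachLongPath_eq_zero hT hr hx hxy
  have h1 : ∀ x, x ∉ Set.range (fun a : V => some (Sum.inl a)) →
      QutAlgebra.u (attachLongPath T r) (fun _ => ()) x x = 1 :=
    fun x hx => hu.self_eq_one fun y hy => (h0 x y hx hy.symm).1
  rintro (_ | a | i) (_ | b | j) <;> simp only [extendByOne, map_zero, map_one]
  · exact (h1 _ (by simp)).symm
  · exact ((h0 _ _ (by simp) (by simp)).1).symm
  · exact ((h0 _ _ (by simp) (by simp)).1).symm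
  · exact ((h0 _ _ (by simp) (by simp)).2).symm
  · exact QutAlgebra.lift_u _ _ _
  · exact ((h0 _ _ (by simp) (by simp)).2).symm
  · exact ((h0 _ _ (by simp) (by simp)).1).symm
  · exact ((h0 _ _ (by simp) (by simp)).1).symm
  · split_ifs with h
    · subst h
      rw [map_one, h1 _ (by simp)]
    · rw [map_zero, (h0 _ _ (by simp) (by simpa using h)).1]

end AttachLongPath

/-! ### Paths rooted at an endpoint -/

section PathRootedAtEnd

variable {V : Type u} {T : SimpleGraph V} {r : V}

/-- The distance from the root is the position along the path. -/
theorem IsPathRootedAtEnd.dist_injective (h : IsPathRootedAtEnd T r) :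
    Function.Injective (T.dist r) := by
  obtain ⟨n, e, he⟩ := h
  have h1 : ∀ b, T.dist r b = e b := by
    refine SimpleGraph.dist_eq_of_forall_adj (fun b => ?_) (fun b c h => ?_) fun b m h => ?_
    · rw [← e.injective.eq_iff, he, Fin.ext_iff, Fin.val_zero]
    · have := SimpleGraph.pathGraph_adj.1 (e.map_rel_iff.2 h)
      omega
    · refine ⟨e.symm ⟨m, by omega⟩, ?_, by simp⟩
      rw [← e.map_rel_iff, RelIso.apply_symm_apply, SimpleGraph.pathGraph_adj]
      exact Or.inl h.symm
  intro a b hab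
  rw [h1, h1] at hab
  exact e.injective (Fin.ext hab)

variable [Fintype V]

open Classical in
theorem isQuantumAut_one {K : Type v} {X : SimpleGraph V} {c : V → K} {A : Type*} [Ring A]
    [StarRing A] : IsQuantumAut X c (fun i j => if i = j then (1 : A) else 0) where
  selfAdjoint i j := by split_ifs <;> simp
  idempotent i j := by split_ifs <;> simp
  row_sum i := by simp
  col_sum i := by simp
  edge i j k l h := by
    split_ifs with h1 h2 h2
    · subst h1 h2; tauto
    all_goals simp
  color i j h := if_neg fun h' => h (congrArg c h')

/-- The coloring fixes `r`, so distances from `r` are preserved, and here they separate the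
vertices. -/
theorem IsPathRootedAtEnd.eq_zero (h : IsPathRootedAtEnd T r) (hT : T.Connected) {A : Type*}
    [CStarAlgebra A] {w : V → V → A} (hw : IsQuantumAut T (fun x => x = r) w) {i j : V}
    (hij : i ≠ j) : w i j = 0 :=
  hw.eq_zero_of_dist_ne hT (hw.self_eq_one fun j hj => hw.color r j (by simpa using hj))
    (h.dist_injective.ne hij)

/-- Both generating matrices are identity matrices. The single vertex is sent to `r`, but any vertex
would do, as every diagonal entry is `1`. -/
theorem qut_punit_isomorphic_qutRooted (h : IsPathRootedAtEnd T r) (hT : T.Connected) :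
    (Qut (⊥ : SimpleGraph PUnit.{u + 1})).Isomorphic (QutRooted T r) := by
  classical
  have hu := QutAlgebra.isQuantumAut_u T fun x => x = r
  have h1 : ∀ i, QutAlgebra.u T (fun x => x = r) i i = 1 := fun i =>
    hu.self_eq_one fun j hj => h.eq_zero hT hu hj.symm
  have h2 : QutAlgebra.u (⊥ : SimpleGraph PUnit.{u + 1}) (fun _ => ()) PUnit.unit PUnit.unit = 1 :=
    (QutAlgebra.isQuantumAut_u _ _).self_eq_one fun j hj => absurd rfl hj
  refine QutColored.isomorphic_of_extension (e := fun _ => r) (fun _ _ _ => rfl) ?_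
    (fun a k hk => h.eq_zero hT hu fun h' => hk ⟨a, h'⟩) isQuantumAut_one (fun a b => ?_)
    fun i j => ?_
  · convert isQuantumAut_one (X := (⊥ : SimpleGraph PUnit.{u + 1})) (c := fun _ => ()) using 3
    simp [h1]
  · rw [if_pos rfl, h2]
  · split_ifs with hij
    · rw [map_one, ← hij, h1]
    · rw [map_zero, h.eq_zero hT hu hij]

end PathRootedAtEnd

theorem mainTheorem6 {V : Type u} [Fintype V] (T : SimpleGraph V) (r : V) (hT : T.IsTree) :
    (∃ (W : Type u) (_ : Fintype W) (T' : SimpleGraph W),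
      T'.IsTree ∧ (Qut T').Isomorphic (QutRooted T r)) ∧
    (IsPathRootedAtEnd T r →
      (Qut (⊥ : SimpleGraph PUnit.{u + 1})).Isomorphic (QutRooted T r)) ∧
    (¬ IsPathRootedAtEnd T r →
      (attachLongPath T r).IsTree ∧
        (Qut (attachLongPath T r)).Isomorphic (QutRooted T r)) := by
  have h1 : IsPathRootedAtEnd T r →
      (Qut (⊥ : SimpleGraph PUnit.{u + 1})).Isomorphic (QutRooted T r) :=
    fun h => qut_punit_isomorphic_qutRooted h hT.connected
  have h2 : ¬ IsPathRootedAtEnd T r → (attachLongPath T r).IsTree ∧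
      (Qut (attachLongPath T r)).Isomorphic (QutRooted T r) :=
    fun h => ⟨attachLongPath_isTree hT,
      (qutRooted_isomorphic_qut_attachLongPath hT.connected h).symm⟩
  refine ⟨?_, h1, h2⟩
  by_cases h : IsPathRootedAtEnd T r
  · exact ⟨PUnit, inferInstance, ⊥, .of_subsingleton, h1 h⟩
  · exact ⟨_, inferInstance, attachLongPath T r, h2 h⟩
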